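/- Let $M$ be a smooth, finite-dimensional, Hausdorff, second countable manifold. Write $\Omega^k(M)$ for the smooth $k$-forms and $\mathfrak X^k(M)$ for the smooth $k$-vector fields (sections of $\bigwedge^k TM$) on $M$, both zero for $k<0$. Contractions are normalized by $\iota_{u_1\wedge\dots\wedge u_p}\omega=\omega(u_1,\dots,u_p,\cdot,\dots,\cdot)$, and for $U\in\mathfrak X^p(M)$ put $\mathscr L_U\omega=\mathrm d\iota_U\omega-(-1)^p\iota_U\mathrm d\omega$. Let $[\cdot,\cdot]$ be the Schouten–Nijenhuis bracket, with the signs fixed by $$[X_1\wedge\dots\wedge X_p,\,Y_1\wedge\dots\wedge Y_q]=\sum_{i,j}(-1)^{i+j}[X_i,Y_j]\wedge X_1\wedge\cdots\widehat{X_i}\cdots\wedge X_p\wedge Y_1\wedge\cdots\widehat{Y_j}\cdots\wedge Y_q$$ for vector fields $X_i,Y_j$, by $[X,f]=X(f)$ for a vector field $X$ and a function $f$, and by the graded rules $[P,Q]=-(-1)^{(p-1)(q-1)}[Q,P]$ and $[P,Q\wedge R]=[P,Q]\wedge R+(-1)^{(p-1)q}Q\wedge[P,R]$ for $P,Q,R$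 of degrees $p,q,r$. Let $\Theta\in\Omega^n(M)$ be an arbitrary smooth $n$-form. A multivector field $X\in\mathfrak X^p(M)$ is an *infinitesimal conformal transformation* of $\Theta$, with *conformal factor* $V\in\mathfrak X^{p-1}(M)$, if $\mathscr L_X\Theta=\iota_V\Theta$. A form $\alpha\in\Omega^{n-p}(M)$ is *conformal Hamiltonian* if $\iota_X\Theta=-\alpha$ for some infinitesimal conformal transformation $X\in\mathfrak X^p(M)$ of $\Theta$. **Theorem.** Let $\alpha\in\Omega^{n-p}(M)$ and $\beta\in\Omega^{n-q}(M)$ be conformal Hamiltonian forms. Consider multivector fields $X_\alpha\in\mathfrak X^p(M)$, $V_\alpha\in\mathfrak X^{p-1}(M)$, $X_\beta\in\mathfrak X^q(M)$, $V_\beta\in\mathfrak X^{q-1}(M)$ with $$\iota_{X_\alpha}\Theta=-\alpha,\qquad \iota_{X_\alpha}\mathrm d\Theta=(-1)^{p+1}(\mathrm d\alpha+\iota_{V_\alpha}\Theta),$$ $$\iota_{X_\beta}\Theta=-\beta,\qquad \iota_{X_\beta}\mathrm d\Theta=(-1)^{q+1}(\mathrm d\beta+\iota_{V_\beta}\Theta).$$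 Then: 1. The form $-\iota_{[X_\alpha,X_\beta]}\Theta$ is the same for all such choices of $X_\alpha,V_\alpha,X_\beta,V_\beta$. 2. For every such choice, $[X_\alpha,X_\beta]\in\mathfrak X^{p+q-1}(M)$ is an infinitesimal conformal transformation of $\Theta$ with conformal factor $[X_\alpha,V_\beta]-(-1)^{(p-1)(q-1)}[X_\beta,V_\alpha]\in\mathfrak X^{p+q-2}(M)$, and $-\iota_{[X_\alpha,X_\beta]}\Theta\in\Omega^{n-(p+q-1)}(M)$ is a conformal Hamiltonian form. 3. Consequently there is exactly one form $\{\alpha,\beta\}$ (the graded Jacobi bracket of $\alpha$ and $\beta$) such that $\{\alpha,\beta\}=-\iota_{[X_\alpha,X_\beta]}\Theta$ for all such choices. -/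

import Mathlib

open scoped Manifold ContDiff

noncomputable section

namespace ConformalHamiltonian

/-! ### Multilinear algebra of one finite-dimensional vector space -/

section Fibre

variable {V : Type*} [AddCommGroup V] [Module ℝ V]

/-- The elements of degree `d` of the exterior algebra, for an integer `d`: this is `⋀^d V` if
`0 ≤ d`, and only the zero vector if `d < 0`. -/
def vectorsOfDegree (V : Type*) [AddCommGroup V] [Module ℝ V] (d : ℤ) :
    Submodule ℝ (ExteriorAlgebra ℝ V) :=
  if 0 ≤ d then ⋀[ℝ]^d.toNat V else ⊥

variable [TopologicalSpace V] [IsTopologicalAddGroup V] [ContinuousSMul ℝ V] [T2Space V]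
  [FiniteDimensional ℝ V]

/-- On a finite-dimensional space every multilinear form is continuous. -/
theorem continuous_multilinearMap {k : ℕ} (f : MultilinearMap ℝ (fun _ : Fin k => V) ℝ) :
    Continuous f := by
  have key : ∀ v : Fin k → V, f v = ∑ r : Fin k → Fin (Module.finrank ℝ V),
      (∏ i, (Module.finBasis ℝ V).repr (v i) (r i)) •
        f (fun i => Module.finBasis ℝ V (r i)) := by
    intro v
    conv_lhs => rw [show v = fun i => ∑ j, (Module.finBasis ℝ V).repr (v i) j •
      Module.finBasis ℝ V j from funext fun i => ((Module.finBasis ℝ V).sum_repr (v i)).symm]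
    rw [MultilinearMap.map_sum]
    exact Finset.sum_congr rfl fun r _ => MultilinearMap.map_smul_univ _ _ _
  rw [show (f : (Fin k → V) → ℝ) = _ from funext key]
  simp only [smul_eq_mul]
  refine continuous_finsetSum _ fun r _ => Continuous.mul ?_ continuous_const
  refine continuous_finsetProd _ fun i _ => ?_
  exact ((Module.finBasis ℝ V).coord (r i)).continuous_of_finiteDimensional.comp
    (continuous_apply i)

/-- The evaluation of a (not necessarily homogeneous) form on the exterior algebra, determined by
`⟨η, v₁ ∧ ⋯ ∧ vₖ⟩ = ηₖ(v₁, …, vₖ)`, where `ηₖ` is the component of `η` of degree `k`. -/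
def pairing (η : ∀ k : ℕ, V [⋀^Fin k]→L[ℝ] ℝ) : ExteriorAlgebra ℝ V →ₗ[ℝ] ℝ :=
  ExteriorAlgebra.liftAlternating fun k => (η k).toAlternatingMap

/-- The contraction of a form with a multivector:
`(ι_U η)(v₁, …, vₖ) = ⟨η, U ∧ v₁ ∧ ⋯ ∧ vₖ⟩`.  In particular
`ι_{u₁ ∧ ⋯ ∧ uₚ} η = η(u₁, …, uₚ, ·, …, ·)` and `ι_{U ∧ W} = ι_W ∘ ι_U`. -/
def contract (U : ExteriorAlgebra ℝ V) (η : ∀ k : ℕ, V [⋀^Fin k]→L[ℝ] ℝ) (k : ℕ) :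
    V [⋀^Fin k]→L[ℝ] ℝ :=
  { (pairing η ∘ₗ LinearMap.mulLeft ℝ U).compAlternatingMap (ExteriorAlgebra.ιMulti ℝ k) with
    cont := continuous_multilinearMap
      ((pairing η ∘ₗ LinearMap.mulLeft ℝ U).compAlternatingMap
        (ExteriorAlgebra.ιMulti ℝ k)).toMultilinearMap }

end Fibre

/-! ### The Schouten–Nijenhuis bracket on a vector space -/

section Flat

variable {E : Type*} [NormedAddCommGroup E] [NormedSpace ℝ E] [FiniteDimensional ℝ E]

instance instFiniteExteriorAlgebra : FiniteDimensional ℝ (ExteriorAlgebra ℝ E) :=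
  Module.Finite.of_basis (Module.finBasis ℝ E).ExteriorAlgebra

/-- The exterior algebra of a finite-dimensional space is finite-dimensional; we norm it by the
coordinates in some basis.  All norms are equivalent, and only derivatives and smoothness of maps
into this space are used, so that the choice of the basis plays no role. -/
instance instNormedAddCommGroupExteriorAlgebra : NormedAddCommGroup (ExteriorAlgebra ℝ E) :=
  NormedAddCommGroup.induced _ _
    (Module.finBasis ℝ (ExteriorAlgebra ℝ E)).equivFun.toLinearMap
    (Module.finBasis ℝ (ExteriorAlgebra ℝ E)).equivFun.injective

instance instNormedSpaceExteriorAlgebra : NormedSpace ℝ (ExteriorAlgebra ℝ E) :=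
  NormedSpace.induced ℝ _ _ (Module.finBasis ℝ (ExteriorAlgebra ℝ E)).equivFun.toLinearMap

/-- The Schouten–Nijenhuis bracket of two multivector fields on a vector space, in linear
coordinates `x^i`, with `∂ᵢ` the componentwise partial derivative.  For `P` of degree `p` it is
`[P, Q] = ∑ᵢ ((-1)^(p-1) (dx^i ⌟ P) ∧ ∂ᵢ Q - ∂ᵢ P ∧ (dx^i ⌟ Q))`;
the sign `(-1)^(p-1)` is the one by which the grade involution acts on `dx^i ⌟ P`.
It is the coordinate form of the bracket given by
`[X₁ ∧ ⋯ ∧ Xₚ, Y₁ ∧ ⋯ ∧ Y_q]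
  = ∑ (-1)^(i+j) [Xᵢ, Yⱼ] ∧ X₁ ∧ ⋯ X̂ᵢ ⋯ ∧ Xₚ ∧ Y₁ ∧ ⋯ Ŷⱼ ⋯ ∧ Y_q`
on vector fields and by `[X, f] = X f` on a vector field and a function, with
`[P, Q] = -(-1)^((p-1)(q-1)) [Q, P]` and
`[P, Q ∧ R] = [P, Q] ∧ R + (-1)^((p-1)q) Q ∧ [P, R]`. -/
def schoutenFlat (P Q : E → ExteriorAlgebra ℝ E) (z : E) : ExteriorAlgebra ℝ E :=
  ∑ i, (CliffordAlgebra.involute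
          (CliffordAlgebra.contractLeft ((Module.finBasis ℝ E).coord i) (P z)) *
            fderiv ℝ Q z (Module.finBasis ℝ E i) -
        fderiv ℝ P z (Module.finBasis ℝ E i) *
          CliffordAlgebra.contractLeft ((Module.finBasis ℝ E).coord i) (Q z))

end Flat

/-! ### Multivector fields and differential forms on a manifold -/

section Manifold

variable (E : Type*) [NormedAddCommGroup E] [NormedSpace ℝ E]
  (M : Type*) [TopologicalSpace M] [ChartedSpace E M]

/-- Sections, not necessarily smooth or homogeneous, of the bundle `⨁ₚ ⋀^p TM`. -/
abbrev MultivectorField := ∀ x : M, ExteriorAlgebra ℝ (TangentSpace 𝓘(ℝ, E) x)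

/-- Families, not necessarily smooth or homogeneous, of alternating forms on the tangent spaces;
`η x k` is the component of degree `k` of `η` at the point `x`. -/
abbrev FormField := ∀ (x : M) (k : ℕ), (TangentSpace 𝓘(ℝ, E) x) [⋀^Fin k]→L[ℝ] ℝ

variable {E M}

/-- The derivative at `y` of the preferred chart at `x₀`. -/
def chartDeriv (x₀ y : M) : TangentSpace 𝓘(ℝ, E) y →L[ℝ] E :=
  mfderiv 𝓘(ℝ, E) 𝓘(ℝ, E) (extChartAt 𝓘(ℝ, E) x₀) y

/-- The derivative at `z` of the inverse of the preferred chart at `x₀`. -/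
def chartSymmDeriv (x₀ : M) (z : E) :
    E →L[ℝ] TangentSpace 𝓘(ℝ, E) ((extChartAt 𝓘(ℝ, E) x₀).symm z) :=
  mfderiv 𝓘(ℝ, E) 𝓘(ℝ, E) (extChartAt 𝓘(ℝ, E) x₀).symm z

/-- The push-forward of a multivector field to the model space along the preferred chart at
`x₀`. -/
def MultivectorField.inChart (P : MultivectorField E M) (x₀ : M) (z : E) : ExteriorAlgebra ℝ E :=
  ExteriorAlgebra.map (chartDeriv x₀ ((extChartAt 𝓘(ℝ, E) x₀).symm z)).toLinearMap
    (P ((extChartAt 𝓘(ℝ, E) x₀).symm z))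

/-- The component of degree `k` of a form, pulled back to the model space along the inverse of the
preferred chart at `x₀`. -/
def FormField.inChart (η : FormField E M) (x₀ : M) (k : ℕ) (z : E) : E [⋀^Fin k]→L[ℝ] ℝ :=
  (η ((extChartAt 𝓘(ℝ, E) x₀).symm z) k).compContinuousLinearMap (chartSymmDeriv x₀ z)

/-- The exterior derivative, computed at `x` in the preferred chart at `x`. -/
def extDer (η : FormField E M) : FormField E M := fun x k =>
  match k with
  | 0 => 0
  | k + 1 => (extDeriv (η.inChart x k) (extChartAt 𝓘(ℝ, E) x x)).compContinuousLinearMap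
      (chartDeriv x x)

variable [FiniteDimensional ℝ E]

/-- `η ∈ Ω^d(M)`: a smooth differential form of degree `d`. For `d < 0` only `η = 0`. -/
structure IsForm (d : ℤ) (η : FormField E M) : Prop where
  smooth : ∀ (x₀ : M) (k : ℕ), ContDiffOn ℝ ∞ (η.inChart x₀ k) (extChartAt 𝓘(ℝ, E) x₀).target
  homogeneous : ∀ (x : M) (k : ℕ), (k : ℤ) ≠ d → η x k = 0

/-- `P ∈ 𝔛^d(M)`: a smooth multivector field of degree `d`. For `d < 0` only `P = 0`. -/
structure IsMultivectorField (d : ℤ) (P : MultivectorField E M) : Prop where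
  smooth : ∀ x₀ : M, ContDiffOn ℝ ∞ (P.inChart x₀) (extChartAt 𝓘(ℝ, E) x₀).target
  homogeneous : ∀ x : M, P x ∈ vectorsOfDegree (TangentSpace 𝓘(ℝ, E) x) d

/-- The interior product `ι_P η` of a multivector field with a form. -/
def interiorProd (P : MultivectorField E M) (η : FormField E M) : FormField E M := fun x k =>
  haveI : T2Space (TangentSpace 𝓘(ℝ, E) x) := inferInstanceAs (T2Space E)
  haveI : FiniteDimensional ℝ (TangentSpace 𝓘(ℝ, E) x) :=
    inferInstanceAs (FiniteDimensional ℝ E)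
  contract (P x) (η x) k

/-- The Schouten–Nijenhuis bracket `[P, Q]`, computed at `x` in the preferred chart at `x`. -/
def schouten (P Q : MultivectorField E M) : MultivectorField E M := fun x =>
  ExteriorAlgebra.map (chartDeriv x x).inverse.toLinearMap
    (schoutenFlat (P.inChart x) (Q.inChart x) (extChartAt 𝓘(ℝ, E) x x))

/-- The Lie derivative `ℒ_P η = d ι_P η - (-1)^p ι_P dη` along a multivector field `P` of
degree `p`. -/
def lieDer (p : ℤ) (P : MultivectorField E M) (η : FormField E M) : FormField E M :=
  extDer (interiorProd P η) - (-1 : ℝ) ^ p • interiorProd P (extDer η)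

/-- `X ∈ 𝔛^p(M)` is an infinitesimal conformal transformation of `Θ` with conformal factor
`V ∈ 𝔛^(p-1)(M)`. -/
structure IsInfConformalWith (Θ : FormField E M) (p : ℤ) (X V : MultivectorField E M) : Prop where
  isMultivectorField : IsMultivectorField p X
  isMultivectorField_factor : IsMultivectorField (p - 1) V
  lieDer_eq : lieDer p X Θ = interiorProd V Θ

/-- `X ∈ 𝔛^p(M)` is an infinitesimal conformal transformation of `Θ`. -/
def IsInfConformal (Θ : FormField E M) (p : ℤ) (X : MultivectorField E M) : Prop :=
  ∃ V, IsInfConformalWith Θ p X V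

/-- `α ∈ Ω^(n-p)(M)` is a conformal Hamiltonian form of the `n`-form `Θ`. -/
def IsConformalHamiltonian (n : ℤ) (Θ : FormField E M) (p : ℤ) (α : FormField E M) : Prop :=
  IsForm (n - p) α ∧ ∃ X, IsInfConformal Θ p X ∧ interiorProd X Θ = -α

/-- `X ∈ 𝔛^p(M)` and `V ∈ 𝔛^(p-1)(M)` satisfy
`ι_X Θ = -α` and `ι_X dΘ = (-1)^(p+1) (dα + ι_V Θ)`. -/
structure IsHamiltonianPair (Θ : FormField E M) (p : ℤ) (α : FormField E M)
    (X V : MultivectorField E M) : Prop where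
  isMultivectorField : IsMultivectorField p X
  isMultivectorField_factor : IsMultivectorField (p - 1) V
  interiorProd_eq : interiorProd X Θ = -α
  interiorProd_extDer_eq :
    interiorProd X (extDer Θ) = (-1 : ℝ) ^ (p + 1) • (extDer α + interiorProd V Θ)

end Manifold

end ConformalHamiltonian

end

open ConformalHamiltonian

/-!
A form `η` is the same thing as a linear functional on the exterior algebra of the tangent space
(`pairing`), and then contraction with `U` is dual to left multiplication by `U`
(`pairing_contract`).  In linear coordinates the exterior derivative becomes
`⟨dη, w⟩ = ∑ⱼ ⟨∂ⱼη, dx^j ⌟ w⟩` (`pairing_flatExtDer`).  Since `dx^j ⌟` is an antiderivation and the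
exterior algebra is graded commutative, a computation with first derivatives only gives the graded
Cartan formula `contract_schoutenFlat`:
`ι_{[P, Q]} = (-1)^((p-1)q) ℒ_P ι_Q - ι_Q ℒ_P`.

The right-hand side is natural under changes of coordinates, because `d` and contractions are, and
forms separate multivectors.  Hence the bracket is natural as well (`schoutenFlat_pushforward`), so
that the chartwise definitions of `d` and of the bracket agree in all charts, and the Cartan formula
holds on the manifold (`interiorProd_schouten`).  With `d² = 0` it implies
`ℒ_{[P, Q]} = (-1)^((p-1)(q-1)) ℒ_P ℒ_Q - ℒ_Q ℒ_P` (`lieDer_schouten`).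

Now let `ι_X Θ = -α` and `ι_Y Θ = -β`.  The remaining conditions on the factors `V` and `W` say that
`ℒ_X Θ = ι_V Θ` and `ℒ_Y Θ = ι_W Θ` (`lieDer_eq_iff_of_interiorProd_eq`).  Therefore
`ι_{[X, Y]} Θ = (-1)^((p-1)q) ℒ_X ι_Y Θ - ι_Y ι_V Θ`
involves `Y` only through `ι_Y Θ = -β`, as contractions commute up to sign; by antisymmetry of the
bracket the same is true of `X`, so the form depends on `α` and `β` alone.  The conformal factor of
`[X, Y]` results from writing `ℒ_{[X, Y]} Θ` as
`(-1)^((p-1)(q-1)) ℒ_X ι_W Θ - ℒ_Y ι_V Θ` and comparing with the Cartan formula for `[X, W]` and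
`[Y, V]`, where the terms `ι_V ι_W Θ` cancel.
-/

noncomputable section

namespace ConformalHamiltonian

/-! ### Graded algebra in the exterior algebra -/

section Algebra

variable {V : Type*} [AddCommGroup V] [Module ℝ V]

/-- The wedge product with a vector moves past a multivector at the cost of the grade
involution. -/
theorem ι_mul_eq_involute_mul_ι (v : V) (b : ExteriorAlgebra ℝ V) :
    ExteriorAlgebra.ι ℝ v * b = CliffordAlgebra.involute b * ExteriorAlgebra.ι ℝ v := by
  induction b using ExteriorAlgebra.induction with
  | algebraMap r =>
    rw [AlgHom.commutes, Algebra.commutes]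
  | ι x =>
    rw [eq_neg_of_add_eq_zero_left (ExteriorAlgebra.ι_add_mul_swap v x),
      show CliffordAlgebra.involute (ExteriorAlgebra.ι ℝ x) = -ExteriorAlgebra.ι ℝ x from
        CliffordAlgebra.involute_ι x, neg_mul]
  | mul a b ha hb => rw [← mul_assoc, ha, mul_assoc, hb, ← mul_assoc, map_mul]
  | add a b ha hb => rw [mul_add, ha, hb, map_add, add_mul]

/-- Contraction with a covector is an antiderivation. -/
theorem contractLeft_mul (f : Module.Dual ℝ V) (a b : ExteriorAlgebra ℝ V) :
    CliffordAlgebra.contractLeft f (a * b) =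
      CliffordAlgebra.contractLeft f a * b +
        CliffordAlgebra.involute a * CliffordAlgebra.contractLeft f b := by
  induction a using ExteriorAlgebra.induction generalizing b with
  | algebraMap r =>
    rw [show CliffordAlgebra.contractLeft f (algebraMap ℝ (ExteriorAlgebra ℝ V) r) = 0 from
      CliffordAlgebra.contractLeft_algebraMap .., AlgHom.commutes, zero_mul, zero_add]
    exact CliffordAlgebra.contractLeft_algebraMap_mul ..
  | ι x =>
    rw [show CliffordAlgebra.contractLeft f (ExteriorAlgebra.ι ℝ x * b) =
          f x • b - ExteriorAlgebra.ι ℝ x * CliffordAlgebra.contractLeft f b from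
        CliffordAlgebra.contractLeft_ι_mul ..,
      show CliffordAlgebra.contractLeft f (ExteriorAlgebra.ι ℝ x) = algebraMap ℝ _ (f x) from
        CliffordAlgebra.contractLeft_ι ..,
      show CliffordAlgebra.involute (ExteriorAlgebra.ι ℝ x) = -ExteriorAlgebra.ι ℝ x from
        CliffordAlgebra.involute_ι x, neg_mul, ← sub_eq_add_neg, Algebra.smul_def]
  | mul a a' ha ha' =>
    rw [mul_assoc, ha, ha', ha a', map_mul, mul_add, add_mul, mul_assoc, mul_assoc, mul_assoc,
      add_assoc]
  | add a a' ha ha' => rw [add_mul, map_add, map_add, map_add, ha, ha', add_mul, add_mul]; abel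

/-- Contraction of a decomposable multivector with a covector: the Laplace expansion. -/
theorem contractLeft_ιMulti (f : Module.Dual ℝ V) {k : ℕ} (v : Fin (k + 1) → V) :
    CliffordAlgebra.contractLeft f (ExteriorAlgebra.ιMulti ℝ (k + 1) v) =
      ∑ i : Fin (k + 1), ((-1 : ℝ) ^ (i : ℕ) * f (v i)) •
        ExteriorAlgebra.ιMulti ℝ k (i.removeNth v) := by
  have hstep : ∀ (m : ℕ) (w : Fin (m + 1) → V),
      CliffordAlgebra.contractLeft f (ExteriorAlgebra.ιMulti ℝ (m + 1) w) =
        f (w 0) • ExteriorAlgebra.ιMulti ℝ m (fun i => w i.succ) -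
          ExteriorAlgebra.ι ℝ (w 0) *
            CliffordAlgebra.contractLeft f (ExteriorAlgebra.ιMulti ℝ m (fun i => w i.succ)) := by
    intro m w
    rw [ExteriorAlgebra.ιMulti_succ_apply]
    exact CliffordAlgebra.contractLeft_ι_mul ..
  induction k with
  | zero =>
    rw [hstep]
    simp only [ExteriorAlgebra.ιMulti_zero_apply, Fin.sum_univ_succ, Finset.univ_eq_empty,
      Finset.sum_empty, Fin.val_zero, pow_zero, one_mul, add_zero]
    rw [show CliffordAlgebra.contractLeft f (1 : ExteriorAlgebra ℝ V) = 0 from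
      CliffordAlgebra.contractLeft_one .., mul_zero, sub_zero]
  | succ k ih =>
    rw [hstep, ih, Fin.sum_univ_succ (n := k + 1), sub_eq_add_neg, Finset.mul_sum,
      ← Finset.sum_neg_distrib]
    congr 1
    · simp only [Fin.val_zero, pow_zero, one_mul]
      rfl
    · refine Finset.sum_congr rfl fun i _ => ?_
      rw [mul_smul_comm, ExteriorAlgebra.ιMulti_succ_apply, Fin.val_succ, pow_succ, ← neg_smul]
      have h0 : i.succ.removeNth v 0 = v 0 := by simp [Fin.removeNth]
      have h1 : Matrix.vecTail (i.succ.removeNth v) = i.removeNth (fun j => v j.succ) := by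
        ext j
        simp [Matrix.vecTail, Fin.removeNth]
      rw [h0, h1]
      congr 1
      ring

theorem mem_vectorsOfDegree_natCast {k : ℕ} {a : ExteriorAlgebra ℝ V} :
    a ∈ vectorsOfDegree V k ↔ a ∈ ⋀[ℝ]^k V := by
  simp [vectorsOfDegree]

theorem ιMulti_mem_vectorsOfDegree (k : ℕ) (v : Fin k → V) :
    ExteriorAlgebra.ιMulti ℝ k v ∈ vectorsOfDegree V k :=
  mem_vectorsOfDegree_natCast.2 (ExteriorAlgebra.ιMulti_range ℝ k ⟨v, rfl⟩)

/-- To prove a linear property of the multivectors of a given degree, it suffices to consider the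
decomposable ones. -/
theorem vectorsOfDegree_induction {C : ℤ → ExteriorAlgebra ℝ V → Prop}
    (hι : ∀ (k : ℕ) (v : Fin k → V), C k (ExteriorAlgebra.ιMulti ℝ k v))
    (h0 : ∀ d, C d 0) (hadd : ∀ d a b, C d a → C d b → C d (a + b))
    (hsmul : ∀ d (r : ℝ) a, C d a → C d (r • a))
    {d : ℤ} {a : ExteriorAlgebra ℝ V} (ha : a ∈ vectorsOfDegree V d) : C d a := by
  rcases lt_or_ge d 0 with hd | hd
  · rw [vectorsOfDegree, if_neg (not_le.2 hd), Submodule.mem_bot] at ha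
    exact ha ▸ h0 d
  · lift d to ℕ using hd
    rw [mem_vectorsOfDegree_natCast, ← ExteriorAlgebra.ιMulti_span_fixedDegree] at ha
    induction ha using Submodule.span_induction with
    | mem x hx => obtain ⟨v, rfl⟩ := hx; exact hι d v
    | zero => exact h0 d
    | add x y _ _ hx hy => exact hadd _ _ _ hx hy
    | smul r x _ hx => exact hsmul _ _ _ hx

theorem involute_eq_of_mem {d : ℤ} {a : ExteriorAlgebra ℝ V} (ha : a ∈ vectorsOfDegree V d) :
    CliffordAlgebra.involute a = (-1 : ℝ) ^ d • a := by
  refine vectorsOfDegree_induction (C := fun d a => CliffordAlgebra.involute a = (-1 : ℝ) ^ d • a)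
    (fun k v => ?_) (by simp) (fun d a b ha hb => by rw [map_add, ha, hb, smul_add])
    (fun d r a ha => by rw [map_smul, ha, smul_comm]) ha
  rw [ExteriorAlgebra.ιMulti_apply, zpow_natCast]
  have h := CliffordAlgebra.involute_prod_map_ι (Q := (0 : QuadraticForm ℝ V)) (List.ofFn v)
  rw [List.map_ofFn, List.length_ofFn] at h
  exact h

/-- The exterior algebra is graded commutative. -/
theorem mul_comm_of_mem {d e : ℤ} {a b : ExteriorAlgebra ℝ V} (ha : a ∈ vectorsOfDegree V d)
    (hb : b ∈ vectorsOfDegree V e) : a * b = (-1 : ℝ) ^ (d * e) • (b * a) := by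
  refine vectorsOfDegree_induction (C := fun d a => a * b = (-1 : ℝ) ^ (d * e) • (b * a))
    (fun k v => ?_) (by simp)
    (fun d a a' h h' => by rw [add_mul, h, h', mul_add, smul_add])
    (fun d r a h => by rw [smul_mul_assoc, h, mul_smul_comm, smul_comm]) ha
  induction k with
  | zero => simp
  | succ k ih =>
    rw [ExteriorAlgebra.ιMulti_succ_apply, mul_assoc, ih, mul_smul_comm, ← mul_assoc,
      ι_mul_eq_involute_mul_ι, involute_eq_of_mem hb, smul_mul_assoc, smul_mul_assoc, smul_smul,
      mul_assoc]
    congr 1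
    rw [← zpow_add₀ (by norm_num)]
    congr 1
    push_cast
    ring

theorem mul_mem_vectorsOfDegree {d e : ℤ} {a b : ExteriorAlgebra ℝ V}
    (ha : a ∈ vectorsOfDegree V d) (hb : b ∈ vectorsOfDegree V e) :
    a * b ∈ vectorsOfDegree V (d + e) := by
  refine vectorsOfDegree_induction (C := fun d a => a * b ∈ vectorsOfDegree V (d + e))
    (fun k v => ?_) (by simp)
    (fun d a a' h h' => by rw [add_mul]; exact add_mem h h')
    (fun d r a h => by rw [smul_mul_assoc]; exact Submodule.smul_mem _ r h) ha
  refine vectorsOfDegree_induction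
    (C := fun e b => ExteriorAlgebra.ιMulti ℝ k v * b ∈ vectorsOfDegree V (k + e))
    (fun l w => ?_) (by simp)
    (fun d a a' h h' => by rw [mul_add]; exact add_mem h h')
    (fun d r a h => by rw [mul_smul_comm]; exact Submodule.smul_mem _ r h) hb
  rw [← Nat.cast_add, mem_vectorsOfDegree_natCast]
  exact SetLike.mul_mem_graded (A := fun i : ℕ => ⋀[ℝ]^i V)
    (ExteriorAlgebra.ιMulti_range ℝ k ⟨v, rfl⟩) (ExteriorAlgebra.ιMulti_range ℝ l ⟨w, rfl⟩)

theorem contractLeft_mem_vectorsOfDegree {d : ℤ} {a : ExteriorAlgebra ℝ V}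
    (f : Module.Dual ℝ V) (ha : a ∈ vectorsOfDegree V d) :
    CliffordAlgebra.contractLeft f a ∈ vectorsOfDegree V (d - 1) := by
  refine vectorsOfDegree_induction
    (C := fun d a => CliffordAlgebra.contractLeft f a ∈ vectorsOfDegree V (d - 1))
    (fun k v => ?_) (by simp)
    (fun d a a' h h' => by rw [map_add]; exact add_mem h h')
    (fun d r a h => by rw [map_smul]; exact Submodule.smul_mem _ r h) ha
  cases k with
  | zero =>
    rw [ExteriorAlgebra.ιMulti_zero_apply, show CliffordAlgebra.contractLeft f
      (1 : ExteriorAlgebra ℝ V) = 0 from CliffordAlgebra.contractLeft_one ..]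
    exact zero_mem _
  | succ k =>
    rw [contractLeft_ιMulti, Nat.cast_succ, add_sub_cancel_right]
    exact Submodule.sum_mem _ fun i _ => Submodule.smul_mem _ _ (ιMulti_mem_vectorsOfDegree k _)

theorem map_mem_vectorsOfDegree {W : Type*} [AddCommGroup W] [Module ℝ W] (f : V →ₗ[ℝ] W)
    {d : ℤ} {a : ExteriorAlgebra ℝ V} (ha : a ∈ vectorsOfDegree V d) :
    ExteriorAlgebra.map f a ∈ vectorsOfDegree W d := by
  refine vectorsOfDegree_induction
    (C := fun d a => ExteriorAlgebra.map f a ∈ vectorsOfDegree W d)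
    (fun k v => ?_) (by simp)
    (fun d a a' h h' => by rw [map_add]; exact add_mem h h')
    (fun d r a h => by rw [map_smul]; exact Submodule.smul_mem _ r h) ha
  rw [ExteriorAlgebra.map_apply_ιMulti]
  exact ιMulti_mem_vectorsOfDegree _ _

end Algebra

/-! ### Forms as linear functionals on the exterior algebra -/

section Pairing

variable {V : Type*} [AddCommGroup V] [Module ℝ V]

/-- A linear functional on the exterior algebra is determined by its values on decomposable
multivectors. -/
theorem exteriorAlgebra_linearMap_ext {W : Type*} [AddCommGroup W] [Module ℝ W]
    {f g : ExteriorAlgebra ℝ V →ₗ[ℝ] W}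
    (h : ∀ (k : ℕ) (v : Fin k → V), f (ExteriorAlgebra.ιMulti ℝ k v) =
      g (ExteriorAlgebra.ιMulti ℝ k v)) : f = g :=
  ExteriorAlgebra.lhom_ext fun k => AlternatingMap.ext (h k)

variable [TopologicalSpace V]

theorem pairing_ιMulti (η : ∀ k : ℕ, V [⋀^Fin k]→L[ℝ] ℝ) {k : ℕ} (v : Fin k → V) :
    pairing η (ExteriorAlgebra.ιMulti ℝ k v) = η k v :=
  ExteriorAlgebra.liftAlternating_apply_ιMulti _ _

theorem pairing_injective :
    Function.Injective (pairing : (∀ k : ℕ, V [⋀^Fin k]→L[ℝ] ℝ) → _) := by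
  intro η η' h
  funext k
  ext v
  rw [← pairing_ιMulti η, h, pairing_ιMulti]

theorem pairing_add [ContinuousAdd V] (η η' : ∀ k : ℕ, V [⋀^Fin k]→L[ℝ] ℝ) :
    pairing (η + η') = pairing η + pairing η' :=
  exteriorAlgebra_linearMap_ext fun k v => by
    simp [pairing_ιMulti]

theorem pairing_smul (r : ℝ) (η : ∀ k : ℕ, V [⋀^Fin k]→L[ℝ] ℝ) :
    pairing (r • η) = r • pairing η :=
  exteriorAlgebra_linearMap_ext fun k v => by
    simp [pairing_ιMulti]

theorem pairing_compContinuousLinearMap {W : Type*} [AddCommGroup W] [Module ℝ W]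
    [TopologicalSpace W] (η : ∀ k : ℕ, W [⋀^Fin k]→L[ℝ] ℝ) (f : V →L[ℝ] W)
    (u : ExteriorAlgebra ℝ V) :
    pairing (fun k => (η k).compContinuousLinearMap f) u =
      pairing η (ExteriorAlgebra.map f.toLinearMap u) := by
  refine LinearMap.congr_fun (f := pairing fun k => (η k).compContinuousLinearMap f)
    (g := pairing η ∘ₗ (ExteriorAlgebra.map f.toLinearMap).toLinearMap)
    (exteriorAlgebra_linearMap_ext fun k v => ?_) u
  rw [pairing_ιMulti, LinearMap.comp_apply, AlgHom.toLinearMap_apply,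
    ExteriorAlgebra.map_apply_ιMulti, pairing_ιMulti]
  rfl

variable [IsTopologicalAddGroup V] [ContinuousSMul ℝ V] [T2Space V] [FiniteDimensional ℝ V]

/-- Contraction with `U` is dual to left multiplication by `U`. -/
theorem pairing_contract (U : ExteriorAlgebra ℝ V) (η : ∀ k : ℕ, V [⋀^Fin k]→L[ℝ] ℝ)
    (w : ExteriorAlgebra ℝ V) : pairing (contract U η) w = pairing η (U * w) := by
  refine LinearMap.congr_fun (f := pairing (contract U η))
    (g := pairing η ∘ₗ LinearMap.mulLeft ℝ U)
    (exteriorAlgebra_linearMap_ext fun k v => ?_) w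
  rw [pairing_ιMulti]
  rfl

theorem contract_contract (U W : ExteriorAlgebra ℝ V) (η : ∀ k : ℕ, V [⋀^Fin k]→L[ℝ] ℝ) :
    contract W (contract U η) = contract (U * W) η :=
  pairing_injective <| LinearMap.ext fun w => by
    simp only [pairing_contract, mul_assoc]

theorem contract_add_left (U W : ExteriorAlgebra ℝ V) (η : ∀ k : ℕ, V [⋀^Fin k]→L[ℝ] ℝ) :
    contract (U + W) η = contract U η + contract W η :=
  pairing_injective <| LinearMap.ext fun w => by
    simp only [pairing_add, LinearMap.add_apply, pairing_contract, add_mul, map_add]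

theorem contract_smul_left (r : ℝ) (U : ExteriorAlgebra ℝ V)
    (η : ∀ k : ℕ, V [⋀^Fin k]→L[ℝ] ℝ) : contract (r • U) η = r • contract U η :=
  pairing_injective <| LinearMap.ext fun w => by
    simp only [pairing_smul, LinearMap.smul_apply, pairing_contract, smul_mul_assoc, map_smul]

theorem contract_add_right (U : ExteriorAlgebra ℝ V) (η η' : ∀ k : ℕ, V [⋀^Fin k]→L[ℝ] ℝ) :
    contract U (η + η') = contract U η + contract U η' :=
  pairing_injective <| LinearMap.ext fun w => by
    simp only [pairing_add, LinearMap.add_apply, pairing_contract]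

theorem contract_smul_right (r : ℝ) (U : ExteriorAlgebra ℝ V)
    (η : ∀ k : ℕ, V [⋀^Fin k]→L[ℝ] ℝ) : contract U (r • η) = r • contract U η :=
  pairing_injective <| LinearMap.ext fun w => by
    simp only [pairing_smul, LinearMap.smul_apply, pairing_contract]

/-- Contraction is natural with respect to linear maps. -/
theorem contract_compContinuousLinearMap {W : Type*} [AddCommGroup W] [Module ℝ W]
    [TopologicalSpace W] [IsTopologicalAddGroup W] [ContinuousSMul ℝ W] [T2Space W]
    [FiniteDimensional ℝ W] (f : V →L[ℝ] W) (U : ExteriorAlgebra ℝ V)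
    (η : ∀ k : ℕ, W [⋀^Fin k]→L[ℝ] ℝ) :
    contract U (fun k => (η k).compContinuousLinearMap f) =
      fun k => (contract (ExteriorAlgebra.map f.toLinearMap U) η k).compContinuousLinearMap f :=
  pairing_injective <| LinearMap.ext fun w => by
    rw [pairing_contract, pairing_compContinuousLinearMap, pairing_compContinuousLinearMap,
      pairing_contract, map_mul]

/-- Forms separate multivectors. -/
theorem eq_of_forall_pairing_eq {U W : ExteriorAlgebra ℝ V}
    (h : ∀ η : ∀ k : ℕ, V [⋀^Fin k]→L[ℝ] ℝ, pairing η U = pairing η W) : U = W := by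
  rw [← sub_eq_zero]
  refine (Module.forall_dual_apply_eq_zero_iff ℝ (U - W)).1 fun φ => ?_
  have key : pairing (fun k => { φ.compAlternatingMap (ExteriorAlgebra.ιMulti ℝ k) with
      cont := continuous_multilinearMap
        (φ.compAlternatingMap (ExteriorAlgebra.ιMulti ℝ k)).toMultilinearMap }) = φ :=
    exteriorAlgebra_linearMap_ext fun k v => by
      rw [pairing_ιMulti]
      rfl
  rw [map_sub, sub_eq_zero, ← key]
  exact h _

/-- A form of degree `n` contracted with a multivector of degree `d` has degree `n - d`. -/
theorem contract_eq_zero_of_degree_ne {n d : ℤ} {U : ExteriorAlgebra ℝ V}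
    (hU : U ∈ vectorsOfDegree V d) {η : ∀ k : ℕ, V [⋀^Fin k]→L[ℝ] ℝ}
    (hη : ∀ k : ℕ, (k : ℤ) ≠ n → η k = 0) {k : ℕ} (hk : (k : ℤ) ≠ n - d) :
    contract U η k = 0 := by
  ext v
  rw [← pairing_ιMulti, pairing_contract]
  have hm := mul_mem_vectorsOfDegree hU (ιMulti_mem_vectorsOfDegree k v)
  change _ = (0 : ℝ)
  have hne : d + k ≠ n := fun h => hk (by rw [← h]; ring)
  refine vectorsOfDegree_induction (C := fun e a => e ≠ n → pairing η a = 0)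
    (fun l w hl => ?_) (by simp)
    (fun e a b ha hb he => by rw [map_add, ha he, hb he, add_zero])
    (fun e r a ha he => by rw [map_smul, ha he, smul_zero]) hm hne
  rw [pairing_ιMulti, hη l hl]
  rfl

end Pairing

/-! ### The exterior derivative on a vector space -/

section FlatCalculus

variable {E : Type*} [NormedAddCommGroup E] [NormedSpace ℝ E]

/-- The exterior derivative of an inhomogeneous form on a vector space, component by component. -/
def flatExtDer (η : E → ∀ k : ℕ, E [⋀^Fin k]→L[ℝ] ℝ) (z : E) : ∀ k : ℕ, E [⋀^Fin k]→L[ℝ] ℝ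
  | 0 => 0
  | k + 1 => extDeriv (fun y => η y k) z

theorem flatExtDer_congr {η η' : E → ∀ k : ℕ, E [⋀^Fin k]→L[ℝ] ℝ} {z : E}
    (h : ∀ᶠ y in nhds z, η y = η' y) : flatExtDer η z = flatExtDer η' z := by
  funext k
  cases k with
  | zero => rfl
  | succ k =>
    exact Filter.EventuallyEq.extDeriv_eq (h.mono fun y hy => congrFun hy k)

/-- The exterior derivative commutes with pull-back. -/
theorem flatExtDer_pullback {η : E → ∀ k : ℕ, E [⋀^Fin k]→L[ℝ] ℝ} {τ : E → E} {z : E}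
    (hη : ∀ k, ContDiffAt ℝ ∞ (fun y => η y k) (τ z)) (hτ : ContDiffAt ℝ ∞ τ z) :
    flatExtDer (fun y k => (η (τ y) k).compContinuousLinearMap (fderiv ℝ τ y)) z =
      fun k => (flatExtDer η (τ z) k).compContinuousLinearMap (fderiv ℝ τ z) := by
  funext k
  cases k with
  | zero => ext v; rfl
  | succ k =>
    exact extDeriv_pullback (r := ∞) 
      ((hη k).differentiableAt (by simp)) hτ (by simpa using ENat.LEInfty.out)

theorem contDiffAt_flatExtDer {η : E → ∀ k : ℕ, E [⋀^Fin k]→L[ℝ] ℝ} {z : E}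
    (hη : ∀ k, ContDiffAt ℝ ∞ (fun y => η y k) z) (k : ℕ) :
    ContDiffAt ℝ ∞ (fun y => flatExtDer η y k) z := by
  cases k with
  | zero => exact contDiffAt_const
  | succ k =>
    exact (ContinuousAlternatingMap.alternatizeUncurryFinCLM ℝ E ℝ).contDiff.contDiffAt.comp z
      ((hη k).fderiv_right (m := ∞) (by simp))

theorem flatExtDer_flatExtDer {η : E → ∀ k : ℕ, E [⋀^Fin k]→L[ℝ] ℝ} {z : E}
    (hη : ∀ k, ContDiffAt ℝ ∞ (fun y => η y k) z) : flatExtDer (flatExtDer η) z = 0 := by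
  funext k
  rcases k with _ | _ | k
  · rfl
  · change extDeriv (fun _ => 0) z = 0
    rw [extDeriv, fderiv_const_apply]
    exact map_zero (ContinuousAlternatingMap.alternatizeUncurryFinCLM ℝ E ℝ)
  · exact extDeriv_extDeriv_apply (hη k) (by simpa using ENat.LEInfty.out)

variable [FiniteDimensional ℝ E]

/-- A family of forms is smooth if all its values on vectors are. -/
theorem contDiffAt_pairing {η : E → ∀ k : ℕ, E [⋀^Fin k]→L[ℝ] ℝ} {z : E}
    (h : ∀ (k : ℕ) (v : Fin k → E), ContDiffAt ℝ ∞ (fun y => η y k v) z) :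
    ContDiffAt ℝ ∞ (fun y => LinearMap.toContinuousLinearMap (pairing (η y))) z := by
  set b := Module.finBasis ℝ (ExteriorAlgebra ℝ E) with hb
  have hsum : (fun y => LinearMap.toContinuousLinearMap (pairing (η y))) = fun y =>
      ∑ i, pairing (η y) (b i) • LinearMap.toContinuousLinearMap (b.coord i) := by
    funext y
    ext w
    change pairing (η y) w = _
    conv_lhs => rw [← b.sum_repr w, map_sum]
    simp [mul_comm]
  rw [hsum]
  refine ContDiffAt.sum fun i _ => ContDiffAt.fun_smul ?_ contDiffAt_const
  generalize b i = w
  have hw : w ∈ (⊤ : Submodule ℝ (ExteriorAlgebra ℝ E)) := trivial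
  rw [← ExteriorAlgebra.ιMulti_span] at hw
  induction hw using Submodule.span_induction with
  | mem w hw =>
    obtain ⟨⟨k, v⟩, rfl⟩ := hw
    simp only [pairing_ιMulti]
    exact h k v
  | zero => simp only [map_zero]; exact contDiffAt_const
  | add a b _ _ ha hb => simp only [map_add]; exact ha.add hb
  | smul r a _ ha => simp only [map_smul]; exact ha.const_smul r

/-- A family of forms is smooth if and only if the family of linear functionals on the exterior
algebra that it defines is smooth. -/
theorem contDiffAt_form_iff {η : E → ∀ k : ℕ, E [⋀^Fin k]→L[ℝ] ℝ} {z : E} :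
    (∀ k, ContDiffAt ℝ ∞ (fun y => η y k) z) ↔
      ContDiffAt ℝ ∞ (fun y => LinearMap.toContinuousLinearMap (pairing (η y))) z := by
  constructor
  · exact fun h => contDiffAt_pairing fun k v =>
      (ContinuousAlternatingMap.apply ℝ E ℝ v).contDiff.contDiffAt.comp z (h k)
  · intro h k
    -- The component of degree `k` is a linear, hence continuous, function of the functional.
    have hlin : ∃ L : (ExteriorAlgebra ℝ E →L[ℝ] ℝ) →ₗ[ℝ] E [⋀^Fin k]→L[ℝ] ℝ,
        ∀ φ v, L φ v = φ (ExteriorAlgebra.ιMulti ℝ k v) := by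
      refine ⟨⟨⟨fun φ =>
        { φ.toLinearMap.compAlternatingMap (ExteriorAlgebra.ιMulti ℝ k) with
          cont := continuous_multilinearMap
            (φ.toLinearMap.compAlternatingMap (ExteriorAlgebra.ιMulti ℝ k)).toMultilinearMap },
        fun φ ψ => rfl⟩, fun r φ => rfl⟩, fun φ v => rfl⟩
    obtain ⟨L, hL⟩ := hlin
    refine ((LinearMap.toContinuousLinearMap L).contDiff.contDiffAt.comp z h).congr_of_eventuallyEq
      (Filter.Eventually.of_forall fun y => ?_)
    ext v
    exact ((hL _ v).trans (pairing_ιMulti _ _)).symm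

theorem fderiv_pairing {η : E → ∀ k : ℕ, E [⋀^Fin k]→L[ℝ] ℝ} {z : E}
    (hη : ∀ k, ContDiffAt ℝ ∞ (fun y => η y k) z) (w : ExteriorAlgebra ℝ E) (v : E) :
    fderiv ℝ (fun y => pairing (η y) w) z v =
      fderiv ℝ (fun y => LinearMap.toContinuousLinearMap (pairing (η y))) z v w := by
  have h := ((contDiffAt_form_iff.1 hη).differentiableAt (by simp)).hasFDerivAt
  have h2 := (h.clm_apply (hasFDerivAt_const w z)).fderiv
  simp only [LinearMap.coe_toContinuousLinearMap'] at h2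
  rw [h2]
  simp

/-- The exterior derivative, as a differential operator with coefficients in the endomorphisms of
the dual of the exterior algebra: `⟨dη, w⟩ = ∑ⱼ ⟨∂ⱼη, dx^j ⌟ w⟩`. -/
theorem pairing_flatExtDer {η : E → ∀ k : ℕ, E [⋀^Fin k]→L[ℝ] ℝ} {z : E}
    (hη : ∀ k, ContDiffAt ℝ ∞ (fun y => η y k) z) (w : ExteriorAlgebra ℝ E) :
    pairing (flatExtDer η z) w =
      ∑ j, fderiv ℝ (fun y => LinearMap.toContinuousLinearMap (pairing (η y))) z
        (Module.finBasis ℝ E j)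
        (CliffordAlgebra.contractLeft ((Module.finBasis ℝ E).coord j) w) := by
  set Λ := fderiv ℝ (fun y => LinearMap.toContinuousLinearMap (pairing (η y))) z with hΛ
  set b := Module.finBasis ℝ E with hb
  have key : pairing (flatExtDer η z) = ∑ j, (Λ (b j)).toLinearMap ∘ₗ
      CliffordAlgebra.contractLeft (Q := (0 : QuadraticForm ℝ E)) (b.coord j) := by
    refine exteriorAlgebra_linearMap_ext fun k v => ?_
    rw [pairing_ιMulti, LinearMap.sum_apply]
    cases k with
    | zero =>
      refine (Finset.sum_eq_zero fun j _ => ?_).symm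
      rw [ExteriorAlgebra.ιMulti_zero_apply, LinearMap.comp_apply,
        show CliffordAlgebra.contractLeft (b.coord j) (1 : ExteriorAlgebra ℝ E) = 0 from
          CliffordAlgebra.contractLeft_one .., map_zero]
    | succ k =>
      have hdiff : DifferentiableAt ℝ (fun y => η y k) z := (hη k).differentiableAt (by simp)
      change extDeriv (fun y => η y k) z v = _
      rw [extDeriv_apply hdiff]
      have h1 : ∀ j, ((Λ (b j)).toLinearMap ∘ₗ CliffordAlgebra.contractLeft (b.coord j))
          (ExteriorAlgebra.ιMulti ℝ (k + 1) v) = ∑ i : Fin (k + 1), (-1 : ℝ) ^ (i : ℕ) *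
            (b.coord j (v i) * Λ (b j) (ExteriorAlgebra.ιMulti ℝ k (i.removeNth v))) := by
        intro j
        rw [LinearMap.comp_apply, contractLeft_ιMulti, map_sum]
        refine Finset.sum_congr rfl fun i _ => ?_
        rw [map_smul, smul_eq_mul, mul_assoc]
        rfl
      simp only [h1]
      rw [Finset.sum_comm]
      refine Finset.sum_congr rfl fun i _ => ?_
      rw [← Finset.mul_sum, zsmul_eq_mul]
      push_cast
      congr 1
      have h2 : v i = ∑ j, b.coord j (v i) • b j := (b.sum_repr (v i)).symm
      have h3 : (fun y => η y k (i.removeNth v)) =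
          fun y => pairing (η y) (ExteriorAlgebra.ιMulti ℝ k (i.removeNth v)) := by
        funext y
        rw [pairing_ιMulti]
      rw [h3, fderiv_pairing hη]
      conv_lhs => rw [h2]
      rw [map_sum, sum_apply]
      refine Finset.sum_congr rfl fun j _ => ?_
      rw [map_smul]
      rfl
  rw [key, LinearMap.sum_apply]
  rfl

end FlatCalculus

/-! ### The Schouten–Nijenhuis bracket on a vector space -/

section FlatBracket

variable {E : Type*} [NormedAddCommGroup E] [NormedSpace ℝ E] [FiniteDimensional ℝ E]

/-- Multiplication in the exterior algebra as a continuous bilinear map. -/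
def mulCLM : ExteriorAlgebra ℝ E →L[ℝ] ExteriorAlgebra ℝ E →L[ℝ] ExteriorAlgebra ℝ E :=
  LinearMap.toContinuousLinearMap
    (LinearMap.toContinuousLinearMap.toLinearMap ∘ₗ LinearMap.mul ℝ (ExteriorAlgebra ℝ E))

theorem mulCLM_apply (a b : ExteriorAlgebra ℝ E) : mulCLM a b = a * b := rfl

theorem contDiffAt_exteriorAlgebra_mul {F : Type*} [NormedAddCommGroup F] [NormedSpace ℝ F]
    {P Q : F → ExteriorAlgebra ℝ E} {z : F}
    (hP : ContDiffAt ℝ ∞ P z) (hQ : ContDiffAt ℝ ∞ Q z) :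
    ContDiffAt ℝ ∞ (fun y => P y * Q y) z :=
  (mulCLM.contDiff.contDiffAt.comp z hP).clm_apply hQ

theorem hasFDerivAt_mul_const {P : E → ExteriorAlgebra ℝ E} {z : E} (hP : DifferentiableAt ℝ P z)
    (w : ExteriorAlgebra ℝ E) :
    HasFDerivAt (fun y => P y * w) ((mulCLM.flip w).comp (fderiv ℝ P z)) z :=
  (mulCLM.flip w).hasFDerivAt.comp z hP.hasFDerivAt

/-- The partial derivatives of a multivector field are multivector fields of the same degree. -/
theorem fderiv_mem_vectorsOfDegree {d : ℤ} {P : E → ExteriorAlgebra ℝ E} {z : E}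
    (hP : DifferentiableAt ℝ P z) (h : ∀ᶠ y in nhds z, P y ∈ vectorsOfDegree E d) (v : E) :
    fderiv ℝ P z v ∈ vectorsOfDegree E d := by
  by_contra hv
  -- A linear functional that vanishes on the multivectors of degree `d` vanishes on `P` near `z`,
  -- hence also on the derivative of `P`.
  obtain ⟨f, hf, hle⟩ := Submodule.exists_le_ker_of_notMem hv
  have h1 : HasFDerivAt (fun y => f (P y)) ((LinearMap.toContinuousLinearMap f).comp
      (fderiv ℝ P z)) z :=
    (LinearMap.toContinuousLinearMap f).hasFDerivAt.comp z hP.hasFDerivAt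
  have h2 : HasFDerivAt (fun y => f (P y)) (0 : E →L[ℝ] ℝ) z :=
    (hasFDerivAt_const (0 : ℝ) z).congr_of_eventuallyEq (h.mono fun y hy => hle hy)
  exact hf (DFunLike.congr_fun (h1.unique h2) v)

theorem contDiffAt_contract {P : E → ExteriorAlgebra ℝ E}
    {η : E → ∀ k : ℕ, E [⋀^Fin k]→L[ℝ] ℝ} {z : E} (hP : ContDiffAt ℝ ∞ P z)
    (hη : ∀ k, ContDiffAt ℝ ∞ (fun y => η y k) z) (k : ℕ) :
    ContDiffAt ℝ ∞ (fun y => contract (P y) (η y) k) z := by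
  revert k
  rw [contDiffAt_form_iff] at hη ⊢
  have h : (fun y => LinearMap.toContinuousLinearMap (pairing (contract (P y) (η y)))) =
      fun y => (LinearMap.toContinuousLinearMap (pairing (η y))).comp (mulCLM (P y)) := by
    funext y
    ext w
    exact pairing_contract _ _ _
  rw [h]
  exact hη.clm_comp (mulCLM.contDiff.contDiffAt.comp z hP)

theorem fderiv_pairing_contract {P : E → ExteriorAlgebra ℝ E}
    {η : E → ∀ k : ℕ, E [⋀^Fin k]→L[ℝ] ℝ} {z : E} (hP : ContDiffAt ℝ ∞ P z)
    (hη : ∀ k, ContDiffAt ℝ ∞ (fun y => η y k) z) (v : E) (w : ExteriorAlgebra ℝ E) :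
    fderiv ℝ (fun y => LinearMap.toContinuousLinearMap (pairing (contract (P y) (η y)))) z v w =
      fderiv ℝ (fun y => LinearMap.toContinuousLinearMap (pairing (η y))) z v (P z * w) +
        pairing (η z) (fderiv ℝ P z v * w) := by
  rw [← fderiv_pairing (contDiffAt_contract hP hη)]
  simp only [pairing_contract]
  have h := ((contDiffAt_form_iff.1 hη).differentiableAt (by simp)).hasFDerivAt
  have h2 := (h.clm_apply (hasFDerivAt_mul_const (hP.differentiableAt (by simp)) w)).fderiv
  simp only [LinearMap.coe_toContinuousLinearMap'] at h2
  rw [h2]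
  simp [mulCLM_apply, add_comm]

/-- The Lie derivative `d ι_P η - (-1)^p ι_P dη` along a multivector field of degree `p` on a vector
space. -/
def flatLieDer (p : ℤ) (P : E → ExteriorAlgebra ℝ E)
    (η : E → ∀ k : ℕ, E [⋀^Fin k]→L[ℝ] ℝ) (z : E) : ∀ k : ℕ, E [⋀^Fin k]→L[ℝ] ℝ :=
  flatExtDer (fun y => contract (P y) (η y)) z - (-1 : ℝ) ^ p • contract (P z) (flatExtDer η z)

theorem flatLieDer_congr {p : ℤ} {P : E → ExteriorAlgebra ℝ E}
    {η η' : E → ∀ k : ℕ, E [⋀^Fin k]→L[ℝ] ℝ} {z : E} (h : ∀ᶠ y in nhds z, η y = η' y) :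
    flatLieDer p P η z = flatLieDer p P η' z := by
  rw [flatLieDer, flatLieDer, flatExtDer_congr h,
    flatExtDer_congr (h.mono fun y hy => congrArg (contract (P y)) hy)]

theorem neg_one_zpow_sub_one (p : ℤ) : (-1 : ℝ) ^ (p - 1) = -(-1 : ℝ) ^ p := by
  rw [zpow_sub_one₀ (by norm_num)]
  norm_num

theorem neg_one_zpow_mul_self (p : ℤ) : (-1 : ℝ) ^ p * (-1 : ℝ) ^ p = 1 := by
  rw [← zpow_add₀ (by norm_num), (Even.add_self p).neg_one_zpow]

theorem neg_one_zpow_sub_one_mul (p q : ℤ) :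
    (-1 : ℝ) ^ ((p - 1) * q) = (-1 : ℝ) ^ (p * q) * (-1 : ℝ) ^ q := by
  rw [sub_one_mul, zpow_sub₀ (by norm_num), div_eq_mul_inv,
    inv_eq_of_mul_eq_one_left (neg_one_zpow_mul_self q)]

/-- The contraction with the Schouten–Nijenhuis bracket is a graded commutator of a Lie derivative
and a contraction. -/
theorem contract_schoutenFlat {p q : ℤ} {P Q : E → ExteriorAlgebra ℝ E}
    {η : E → ∀ k : ℕ, E [⋀^Fin k]→L[ℝ] ℝ} {z : E}
    (hP : ContDiffAt ℝ ∞ P z) (hQ : ContDiffAt ℝ ∞ Q z)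
    (hPp : ∀ᶠ y in nhds z, P y ∈ vectorsOfDegree E p)
    (hQq : ∀ᶠ y in nhds z, Q y ∈ vectorsOfDegree E q)
    (hη : ∀ k, ContDiffAt ℝ ∞ (fun y => η y k) z) :
    contract (schoutenFlat P Q z) (η z) =
      (-1 : ℝ) ^ ((p - 1) * q) • flatLieDer p P (fun y => contract (Q y) (η y)) z +
        (-1 : ℝ) • contract (Q z) (flatLieDer p P η z) := by
  refine pairing_injective (LinearMap.ext fun w => ?_)
  rw [neg_one_zpow_sub_one_mul]
  have hQη := contDiffAt_contract hQ hη
  have hPη := contDiffAt_contract hP hη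
  have hPQη := contDiffAt_contract hP hQη
  simp only [flatLieDer, sub_eq_add_neg, ← neg_one_smul ℝ (_ • contract _ _), pairing_add,
    pairing_smul, LinearMap.add_apply, LinearMap.smul_apply, pairing_contract,
    pairing_flatExtDer hPQη, pairing_flatExtDer hQη, pairing_flatExtDer hPη,
    pairing_flatExtDer hη, fderiv_pairing_contract hP hQη, fderiv_pairing_contract hQ hη,
    fderiv_pairing_contract hP hη, schoutenFlat, Finset.sum_mul, map_sum, smul_eq_mul,
    Finset.mul_sum, ← Finset.sum_add_distrib]
  refine Finset.sum_congr rfl fun j _ => ?_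
  set e := Module.finBasis ℝ E j
  set c := CliffordAlgebra.contractLeft (Q := (0 : QuadraticForm ℝ E))
    ((Module.finBasis ℝ E).coord j)
  have hPz := hPp.self_of_nhds
  have hQz := hQq.self_of_nhds
  have ha := fderiv_mem_vectorsOfDegree (hP.differentiableAt (by simp)) hPp e
  have hb := fderiv_mem_vectorsOfDegree (hQ.differentiableAt (by simp)) hQq e
  have hcP : c (P z) ∈ vectorsOfDegree E (p - 1) := contractLeft_mem_vectorsOfDegree _ hPz
  have hcmul : ∀ a b : ExteriorAlgebra ℝ E,
      c (a * b) = c a * b + CliffordAlgebra.involute a * c b :=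
    contractLeft_mul _
  generalize fderiv ℝ (fun y => LinearMap.toContinuousLinearMap (pairing (η y))) z e = D
  generalize pairing (η z) = l
  generalize fderiv ℝ P z e = a at *
  generalize fderiv ℝ Q z e = b at *
  simp only [hcmul, involute_eq_of_mem hPz, involute_eq_of_mem hQz, involute_eq_of_mem hcP,
    neg_one_zpow_sub_one]
  -- Graded commutativity brings `Q` (and `∂ⱼQ`) to the left of `P`, `dx^j ⌟ P` and `∂ⱼP`; after
  -- that, all terms with `∂ⱼη` and all terms with `dx^j ⌟ w` cancel in pairs.
  have e1 : ∀ x, P z * (Q z * x) = (-1 : ℝ) ^ (p * q) • (Q z * (P z * x)) := fun x => by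
      rw [← mul_assoc, mul_comm_of_mem hPz hQz, smul_mul_assoc, mul_assoc]
  have e2 : ∀ x, c (P z) * (Q z * x) =
      ((-1 : ℝ) ^ (p * q) * (-1 : ℝ) ^ q) • (Q z * (c (P z) * x)) :=
    fun x => by
      rw [← mul_assoc, mul_comm_of_mem hcP hQz, neg_one_zpow_sub_one_mul, smul_mul_assoc, mul_assoc]
  have e3 : ∀ x, a * (Q z * x) = (-1 : ℝ) ^ (p * q) • (Q z * (a * x)) := fun x => by
      rw [← mul_assoc, mul_comm_of_mem ha hQz, smul_mul_assoc, mul_assoc]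
  have e4 : ∀ x, c (P z) * (b * x) = ((-1 : ℝ) ^ (p * q) * (-1 : ℝ) ^ q) • (b * (c (P z) * x)) :=
    fun x => by
      rw [← mul_assoc, mul_comm_of_mem hcP hb, neg_one_zpow_sub_one_mul, smul_mul_assoc, mul_assoc]
  simp only [mul_add, add_mul, neg_mul, map_neg, map_add, map_smul, smul_mul_assoc,
    mul_smul_comm, mul_assoc, e1, e2, e3, e4, smul_eq_mul]
  rcases Int.even_or_odd p with hp | hp <;> rcases Int.even_or_odd q with hq | hq
  · rw [hp.neg_one_zpow, hq.neg_one_zpow, (hp.mul_right q).neg_one_zpow]; ring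
  · rw [hp.neg_one_zpow, hq.neg_one_zpow, (hp.mul_right q).neg_one_zpow]; ring
  · rw [hp.neg_one_zpow, hq.neg_one_zpow, (hq.mul_left p).neg_one_zpow]; ring
  · rw [hp.neg_one_zpow, hq.neg_one_zpow, (hp.mul hq).neg_one_zpow]; ring

/-- The bracket lowers the total degree by one. -/
theorem schoutenFlat_mem_vectorsOfDegree {p q : ℤ} {P Q : E → ExteriorAlgebra ℝ E} {z : E}
    (hP : ContDiffAt ℝ ∞ P z) (hQ : ContDiffAt ℝ ∞ Q z)
    (hPp : ∀ᶠ y in nhds z, P y ∈ vectorsOfDegree E p)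
    (hQq : ∀ᶠ y in nhds z, Q y ∈ vectorsOfDegree E q) :
    schoutenFlat P Q z ∈ vectorsOfDegree E (p + q - 1) := by
  refine Submodule.sum_mem _ fun j _ => sub_mem ?_ ?_
  · have hc := contractLeft_mem_vectorsOfDegree ((Module.finBasis ℝ E).coord j) hPp.self_of_nhds
    rw [involute_eq_of_mem hc, smul_mul_assoc, show p + q - 1 = p - 1 + q by ring]
    exact Submodule.smul_mem _ _ (mul_mem_vectorsOfDegree hc
      (fderiv_mem_vectorsOfDegree (hQ.differentiableAt (by simp)) hQq _))
  · rw [show p + q - 1 = p + (q - 1) by ring]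
    exact mul_mem_vectorsOfDegree
      (fderiv_mem_vectorsOfDegree (hP.differentiableAt (by simp)) hPp _)
      (contractLeft_mem_vectorsOfDegree _ hQq.self_of_nhds)

/-- The bracket is graded antisymmetric. -/
theorem schoutenFlat_antisymm {p q : ℤ} {P Q : E → ExteriorAlgebra ℝ E} {z : E}
    (hP : ContDiffAt ℝ ∞ P z) (hQ : ContDiffAt ℝ ∞ Q z)
    (hPp : ∀ᶠ y in nhds z, P y ∈ vectorsOfDegree E p)
    (hQq : ∀ᶠ y in nhds z, Q y ∈ vectorsOfDegree E q) :
    schoutenFlat P Q z = -(-1 : ℝ) ^ ((p - 1) * (q - 1)) • schoutenFlat Q P z := by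
  rw [schoutenFlat, schoutenFlat, Finset.smul_sum]
  refine Finset.sum_congr rfl fun j _ => ?_
  have hcP := contractLeft_mem_vectorsOfDegree ((Module.finBasis ℝ E).coord j) hPp.self_of_nhds
  have hcQ := contractLeft_mem_vectorsOfDegree ((Module.finBasis ℝ E).coord j) hQq.self_of_nhds
  have ha := fderiv_mem_vectorsOfDegree (hP.differentiableAt (by simp)) hPp
    (Module.finBasis ℝ E j)
  have hb := fderiv_mem_vectorsOfDegree (hQ.differentiableAt (by simp)) hQq
    (Module.finBasis ℝ E j)
  rw [involute_eq_of_mem hcP, involute_eq_of_mem hcQ, smul_mul_assoc, smul_mul_assoc,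
    mul_comm_of_mem hcP hb, mul_comm_of_mem ha hcQ, smul_sub, smul_smul, smul_smul,
    mul_comm p, neg_one_zpow_sub_one_mul, neg_one_zpow_sub_one_mul, neg_one_zpow_sub_one_mul,
    neg_one_zpow_sub_one, neg_one_zpow_sub_one, mul_sub_one, zpow_sub₀ (by norm_num),
    mul_comm q]
  rcases Int.even_or_odd p with hp | hp <;> rcases Int.even_or_odd q with hq | hq
  · rw [hp.neg_one_zpow, hq.neg_one_zpow, (hp.mul_right q).neg_one_zpow]; module
  · rw [hp.neg_one_zpow, hq.neg_one_zpow, (hp.mul_right q).neg_one_zpow]; module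
  · rw [hp.neg_one_zpow, hq.neg_one_zpow, (hq.mul_left p).neg_one_zpow]; module
  · rw [hp.neg_one_zpow, hq.neg_one_zpow, (hp.mul hq).neg_one_zpow]; module

theorem contDiffAt_schoutenFlat {P Q : E → ExteriorAlgebra ℝ E} {z : E}
    (hP : ContDiffAt ℝ ∞ P z) (hQ : ContDiffAt ℝ ∞ Q z) :
    ContDiffAt ℝ ∞ (schoutenFlat P Q) z := by
  have hlin : ∀ (L : ExteriorAlgebra ℝ E →ₗ[ℝ] ExteriorAlgebra ℝ E) {R : E → ExteriorAlgebra ℝ E},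
      ContDiffAt ℝ ∞ R z → ContDiffAt ℝ ∞ (fun y => L (R y)) z := fun L R hR =>
    (LinearMap.toContinuousLinearMap L).contDiff.contDiffAt.comp z hR
  refine ContDiffAt.sum fun j _ => ContDiffAt.sub ?_ ?_
  · exact contDiffAt_exteriorAlgebra_mul
      (hlin (CliffordAlgebra.involute.toLinearMap ∘ₗ CliffordAlgebra.contractLeft _) hP)
      ((hQ.fderiv_right (m := ∞) (by simp)).clm_apply contDiffAt_const)
  · exact contDiffAt_exteriorAlgebra_mul
      ((hP.fderiv_right (m := ∞) (by simp)).clm_apply contDiffAt_const)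
      (hlin (CliffordAlgebra.contractLeft _) hQ)

/-- The Lie derivative commutes with pull-back. -/
theorem flatLieDer_pullback {p : ℤ} {P P' : E → ExteriorAlgebra ℝ E}
    {η : E → ∀ k : ℕ, E [⋀^Fin k]→L[ℝ] ℝ} {τ : E → E} {z : E}
    (hτ : ContDiffAt ℝ ∞ τ z) (hP' : ContDiffAt ℝ ∞ P' (τ z))
    (hη : ∀ k, ContDiffAt ℝ ∞ (fun y => η y k) (τ z))
    (hPP' : ∀ᶠ y in nhds z, P' (τ y) = ExteriorAlgebra.map (fderiv ℝ τ y).toLinearMap (P y)) :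
    flatLieDer p P (fun y k => (η (τ y) k).compContinuousLinearMap (fderiv ℝ τ y)) z =
      fun k => (flatLieDer p P' η (τ z) k).compContinuousLinearMap (fderiv ℝ τ z) := by
  have h1 : flatExtDer (fun y => contract (P y)
        (fun k => (η (τ y) k).compContinuousLinearMap (fderiv ℝ τ y))) z =
      fun k => (flatExtDer (fun y => contract (P' y) (η y)) (τ z) k).compContinuousLinearMap
        (fderiv ℝ τ z) := by
    -- Near `z`, contracting the pull-back with `P` is pulling back the contraction with `P'`.
    rw [← flatExtDer_pullback (contDiffAt_contract hP' hη) hτ]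
    refine flatExtDer_congr (hPP'.mono fun y hy => ?_)
    rw [contract_compContinuousLinearMap, hy]
  rw [flatLieDer, h1, flatExtDer_pullback hη hτ, contract_compContinuousLinearMap,
    ← hPP'.self_of_nhds]
  rfl

/-- The bracket is natural with respect to (local) diffeomorphisms.  Since forms separate
multivectors, this follows from the naturality of the exterior derivative and of contractions. -/
theorem schoutenFlat_pushforward {p q : ℤ} {P P' Q Q' : E → ExteriorAlgebra ℝ E}
    {τ : E → E} {z : E} (hτ : ContDiffAt ℝ ∞ τ z)
    (hP : ContDiffAt ℝ ∞ P z) (hQ : ContDiffAt ℝ ∞ Q z)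
    (hPp : ∀ᶠ y in nhds z, P y ∈ vectorsOfDegree E p)
    (hQq : ∀ᶠ y in nhds z, Q y ∈ vectorsOfDegree E q)
    (hP' : ContDiffAt ℝ ∞ P' (τ z)) (hQ' : ContDiffAt ℝ ∞ Q' (τ z))
    (hPp' : ∀ᶠ y in nhds (τ z), P' y ∈ vectorsOfDegree E p)
    (hQq' : ∀ᶠ y in nhds (τ z), Q' y ∈ vectorsOfDegree E q)
    (hPP' : ∀ᶠ y in nhds z, P' (τ y) = ExteriorAlgebra.map (fderiv ℝ τ y).toLinearMap (P y))
    (hQQ' : ∀ᶠ y in nhds z, Q' (τ y) = ExteriorAlgebra.map (fderiv ℝ τ y).toLinearMap (Q y)) :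
    schoutenFlat P' Q' (τ z) =
      ExteriorAlgebra.map (fderiv ℝ τ z).toLinearMap (schoutenFlat P Q z) := by
  refine eq_of_forall_pairing_eq fun η₀ => ?_
  -- Extend the test form by a constant form near `τ z`, and pull it back along `τ`.
  set η : E → ∀ k : ℕ, E [⋀^Fin k]→L[ℝ] ℝ := fun _ => η₀
  have hη : ∀ y k, ContDiffAt ℝ ∞ (fun y => η y k) y := fun y k => contDiffAt_const
  have hτη : ∀ k, ContDiffAt ℝ ∞
      (fun y => (η (τ y) k).compContinuousLinearMap (fderiv ℝ τ y)) z :=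
    contDiffAt_form_iff.2 <| contDiffAt_pairing fun k v =>
      (η₀ k).toContinuousMultilinearMap.contDiff.contDiffAt.comp z <| contDiffAt_pi.2 fun i =>
        (hτ.fderiv_right (m := ∞) (by simp)).clm_apply contDiffAt_const
  have h1 := contract_schoutenFlat hP' hQ' hPp' hQq' (hη (τ z))
  have h2 := contract_schoutenFlat hP hQ hPp hQq hτη
  have h3 : flatLieDer p P (fun y => contract (Q y)
        (fun k => (η (τ y) k).compContinuousLinearMap (fderiv ℝ τ y))) z =
      fun k => (flatLieDer p P' (fun y => contract (Q' y) (η y)) (τ z) k).compContinuousLinearMap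
        (fderiv ℝ τ z) := by
    rw [← flatLieDer_pullback hτ hP' (contDiffAt_contract hQ' (hη _)) hPP']
    refine flatLieDer_congr (hQQ'.mono fun y hy => ?_)
    rw [contract_compContinuousLinearMap, hy]
  rw [h3, flatLieDer_pullback hτ hP' (hη _) hPP', contract_compContinuousLinearMap,
    contract_compContinuousLinearMap, ← hQQ'.self_of_nhds] at h2
  have h4 := congrArg (fun ζ => pairing ζ 1) h1
  have h5 := congrArg (fun ζ => pairing ζ 1) h2
  simp only [pairing_contract, mul_one, pairing_add, pairing_smul, LinearMap.add_apply,
    LinearMap.smul_apply, pairing_compContinuousLinearMap, map_one] at h4 h5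
  exact h4.trans h5.symm

end FlatBracket

/-! ### Charts -/

section Charts

variable {E : Type*} [NormedAddCommGroup E] [NormedSpace ℝ E]
  {M : Type*} [TopologicalSpace M] [ChartedSpace E M] [IsManifold 𝓘(ℝ, E) ∞ M]

theorem chartDeriv_comp_chartSymmDeriv {x₀ : M} {z : E}
    (hz : z ∈ (extChartAt 𝓘(ℝ, E) x₀).target) :
    (chartDeriv x₀ ((extChartAt 𝓘(ℝ, E) x₀).symm z)).comp (chartSymmDeriv x₀ z) =
      ContinuousLinearMap.id ℝ E := by
  have h := mfderiv_extChartAt_comp_mfderivWithin_extChartAt_symm (I := 𝓘(ℝ, E)) hz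
  rwa [ModelWithCorners.range_eq_univ, mfderivWithin_univ] at h

theorem chartSymmDeriv_comp_chartDeriv {x₀ : M} {z : E}
    (hz : z ∈ (extChartAt 𝓘(ℝ, E) x₀).target) :
    (chartSymmDeriv x₀ z).comp (chartDeriv x₀ ((extChartAt 𝓘(ℝ, E) x₀).symm z)) =
      ContinuousLinearMap.id ℝ (TangentSpace 𝓘(ℝ, E) ((extChartAt 𝓘(ℝ, E) x₀).symm z)) := by
  have h := mfderivWithin_extChartAt_symm_comp_mfderiv_extChartAt (I := 𝓘(ℝ, E)) hz
  rwa [ModelWithCorners.range_eq_univ, mfderivWithin_univ] at h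

theorem chartDeriv_self (x : M) :
    chartDeriv x x = ContinuousLinearMap.id ℝ (TangentSpace 𝓘(ℝ, E) x) :=
  mfderiv_extChartAt_self

/-- The change of coordinates from the preferred chart at `x₀` to the one at `x`. -/
def transition (x₀ x : M) (z : E) : E :=
  extChartAt 𝓘(ℝ, E) x ((extChartAt 𝓘(ℝ, E) x₀).symm z)

omit [IsManifold 𝓘(ℝ, E) ∞ M] in
/-- The domain of the change of coordinates is open. -/
theorem eventually_mem_transition_domain {x₀ x : M} {z : E}
    (hz : z ∈ (extChartAt 𝓘(ℝ, E) x₀).target)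
    (hx : (extChartAt 𝓘(ℝ, E) x₀).symm z ∈ (extChartAt 𝓘(ℝ, E) x).source) :
    ∀ᶠ y in nhds z, y ∈ (extChartAt 𝓘(ℝ, E) x₀).target ∧
      (extChartAt 𝓘(ℝ, E) x₀).symm y ∈ (extChartAt 𝓘(ℝ, E) x).source :=
  Filter.Eventually.and ((isOpen_extChartAt_target x₀).mem_nhds hz)
    ((continuousAt_extChartAt_symm'' hz).eventually
      ((isOpen_extChartAt_source x).mem_nhds hx))

theorem contDiffAt_transition {x₀ x : M} {z : E}
    (hz : z ∈ (extChartAt 𝓘(ℝ, E) x₀).target)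
    (hx : (extChartAt 𝓘(ℝ, E) x₀).symm z ∈ (extChartAt 𝓘(ℝ, E) x).source) :
    ContDiffAt ℝ ∞ (transition x₀ x) z := by
  have h := contDiffWithinAt_ext_coord_change (I := 𝓘(ℝ, E)) (n := ∞) x x₀ (y := z)
    (by simpa [PartialEquiv.trans_source] using ⟨by simpa using hz, by simpa using hx⟩)
  rw [ModelWithCorners.range_eq_univ, contDiffWithinAt_univ] at h
  exact h

theorem fderiv_transition {x₀ x : M} {z : E}
    (hz : z ∈ (extChartAt 𝓘(ℝ, E) x₀).target)
    (hx : (extChartAt 𝓘(ℝ, E) x₀).symm z ∈ (extChartAt 𝓘(ℝ, E) x).source) :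
    fderiv ℝ (transition x₀ x) z =
      (chartDeriv x ((extChartAt 𝓘(ℝ, E) x₀).symm z)).comp (chartSymmDeriv x₀ z) := by
  have h1 : MDifferentiableAt 𝓘(ℝ, E) 𝓘(ℝ, E) (extChartAt 𝓘(ℝ, E) x)
      ((extChartAt 𝓘(ℝ, E) x₀).symm z) :=
    mdifferentiableAt_extChartAt (by simpa using hx)
  have h2 : MDifferentiableAt 𝓘(ℝ, E) 𝓘(ℝ, E) (extChartAt 𝓘(ℝ, E) x₀).symm z := by
    have h := mdifferentiableWithinAt_extChartAt_symm (I := 𝓘(ℝ, E)) hz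
    rwa [ModelWithCorners.range_eq_univ, mdifferentiableWithinAt_univ] at h
  rw [← mfderiv_eq_fderiv]
  exact mfderiv_comp z h1 h2

omit [IsManifold 𝓘(ℝ, E) ∞ M] in
theorem symm_transition {x₀ x : M} {z : E}
    (hx : (extChartAt 𝓘(ℝ, E) x₀).symm z ∈ (extChartAt 𝓘(ℝ, E) x).source) :
    (extChartAt 𝓘(ℝ, E) x).symm (transition x₀ x z) = (extChartAt 𝓘(ℝ, E) x₀).symm z :=
  (extChartAt 𝓘(ℝ, E) x).left_inv hx

omit [IsManifold 𝓘(ℝ, E) ∞ M] in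
theorem transition_mem_target {x₀ x : M} {z : E}
    (hx : (extChartAt 𝓘(ℝ, E) x₀).symm z ∈ (extChartAt 𝓘(ℝ, E) x).source) :
    transition x₀ x z ∈ (extChartAt 𝓘(ℝ, E) x).target :=
  (extChartAt 𝓘(ℝ, E) x).map_source hx

theorem chartSymmDeriv_transition_comp {x₀ x : M} {z : E}
    (hx : (extChartAt 𝓘(ℝ, E) x₀).symm z ∈ (extChartAt 𝓘(ℝ, E) x).source) :
    (chartSymmDeriv x (transition x₀ x z) : E →L[ℝ] E).comp
      (chartDeriv x ((extChartAt 𝓘(ℝ, E) x₀).symm z) : E →L[ℝ] E) =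
      ContinuousLinearMap.id ℝ E := by
  have h := chartSymmDeriv_comp_chartDeriv (transition_mem_target hx)
  have h' : (chartSymmDeriv x (transition x₀ x z) : E →L[ℝ] E).comp
      ((fun y => (chartDeriv x y : E →L[ℝ] E))
        ((extChartAt 𝓘(ℝ, E) x).symm (transition x₀ x z))) = ContinuousLinearMap.id ℝ E := h
  rwa [symm_transition hx] at h'

/-- The coordinate expressions of a form in two charts are related by pull-back. -/
theorem FormField.inChart_transition (η : FormField E M) {x₀ x : M} {z : E} (k : ℕ)
    (hz : z ∈ (extChartAt 𝓘(ℝ, E) x₀).target)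
    (hx : (extChartAt 𝓘(ℝ, E) x₀).symm z ∈ (extChartAt 𝓘(ℝ, E) x).source) :
    η.inChart x₀ k z =
      (η.inChart x k (transition x₀ x z)).compContinuousLinearMap
        (fderiv ℝ (transition x₀ x) z) := by
  have h : ∀ v : E, chartSymmDeriv x (transition x₀ x z)
      (fderiv ℝ (transition x₀ x) z v) = chartSymmDeriv x₀ z v := fun v => by
    rw [fderiv_transition hz hx]
    exact DFunLike.congr_fun (chartSymmDeriv_transition_comp hx) (chartSymmDeriv x₀ z v)
  ext v
  -- The points of `M` with coordinates `z` at `x₀` and `transition x₀ x z` at `x` are only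
  -- propositionally equal; as every tangent space is a copy of `E`, the forms at these points can
  -- be compared as forms on `E`.
  have h2 : η.inChart x k (transition x₀ x z) =
      ((fun y => (η y k : E [⋀^Fin k]→L[ℝ] ℝ)) ((extChartAt 𝓘(ℝ, E) x).symm
        (transition x₀ x z))).compContinuousLinearMap
          (chartSymmDeriv x (transition x₀ x z) : E →L[ℝ] E) := rfl
  rw [h2, symm_transition hx]
  exact congrArg (η ((extChartAt 𝓘(ℝ, E) x₀).symm z) k) (funext fun i => (h (v i)).symm)

theorem map_map_exteriorAlgebra {V₁ V₂ V₃ : Type*} [AddCommGroup V₁] [Module ℝ V₁]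
    [AddCommGroup V₂] [Module ℝ V₂] [AddCommGroup V₃] [Module ℝ V₃] (g : V₂ →ₗ[ℝ] V₃)
    (f : V₁ →ₗ[ℝ] V₂) (a : ExteriorAlgebra ℝ V₁) :
    ExteriorAlgebra.map g (ExteriorAlgebra.map f a) = ExteriorAlgebra.map (g ∘ₗ f) a :=
  DFunLike.congr_fun (ExteriorAlgebra.map_comp_map f g) a

/-- The coordinate expressions of a multivector field in two charts are related by
push-forward. -/
theorem MultivectorField.inChart_transition (P : MultivectorField E M) {x₀ x : M} {z : E}
    (hz : z ∈ (extChartAt 𝓘(ℝ, E) x₀).target)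
    (hx : (extChartAt 𝓘(ℝ, E) x₀).symm z ∈ (extChartAt 𝓘(ℝ, E) x).source) :
    P.inChart x (transition x₀ x z) =
      ExteriorAlgebra.map (fderiv ℝ (transition x₀ x) z).toLinearMap (P.inChart x₀ z) := by
  have h2 : P.inChart x (transition x₀ x z) =
      (fun y => ExteriorAlgebra.map (chartDeriv x y).toLinearMap (P y))
        ((extChartAt 𝓘(ℝ, E) x).symm (transition x₀ x z)) := rfl
  rw [h2, symm_transition hx, MultivectorField.inChart, map_map_exteriorAlgebra,
    fderiv_transition hz hx]
  have h := chartSymmDeriv_comp_chartDeriv hz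
  refine congrArg (fun L : TangentSpace 𝓘(ℝ, E) _ →ₗ[ℝ] E => ExteriorAlgebra.map L (P _))
    (LinearMap.ext fun v => ?_)
  exact congrArg (chartDeriv x ((extChartAt 𝓘(ℝ, E) x₀).symm z)) (DFunLike.congr_fun h v).symm

theorem FormField.apply_eq_inChart (η : FormField E M) (x : M) (k : ℕ) :
    (η x k : E [⋀^Fin k]→L[ℝ] ℝ) = η.inChart x k (extChartAt 𝓘(ℝ, E) x x) := by
  have hs : (chartSymmDeriv x (extChartAt 𝓘(ℝ, E) x x) : E →L[ℝ] E) =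
      ContinuousLinearMap.id ℝ E := by
    have h := mfderivWithin_range_extChartAt_symm (I := 𝓘(ℝ, E)) (x := x)
    rwa [ModelWithCorners.range_eq_univ, mfderivWithin_univ] at h
  have h2 : η.inChart x k (extChartAt 𝓘(ℝ, E) x x) =
      ((fun y => (η y k : E [⋀^Fin k]→L[ℝ] ℝ)) ((extChartAt 𝓘(ℝ, E) x).symm
        (extChartAt 𝓘(ℝ, E) x x))).compContinuousLinearMap
          (chartSymmDeriv x (extChartAt 𝓘(ℝ, E) x x) : E →L[ℝ] E) := rfl
  rw [h2, extChartAt_to_inv, hs]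
  rfl

theorem FormField.ext_inChart {η η' : FormField E M}
    (h : ∀ (x₀ : M) (z : E), z ∈ (extChartAt 𝓘(ℝ, E) x₀).target →
      (fun k => η.inChart x₀ k z) = fun k => η'.inChart x₀ k z) : η = η' := by
  funext x k
  exact (η.apply_eq_inChart x k).trans ((congrFun (h x _ (mem_extChartAt_target x)) k).trans
    (η'.apply_eq_inChart x k).symm)

end Charts

/-! ### Coordinate expressions of the operators on a manifold -/

section Operators

variable {E : Type*} [NormedAddCommGroup E] [NormedSpace ℝ E]
  {M : Type*} [TopologicalSpace M] [ChartedSpace E M]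

/-- A smooth, not necessarily homogeneous, differential form. -/
def IsSmoothForm (η : FormField E M) : Prop :=
  ∀ (x₀ : M) (k : ℕ), ContDiffOn ℝ ∞ (η.inChart x₀ k) (extChartAt 𝓘(ℝ, E) x₀).target

theorem isSmoothForm_iff {η : FormField E M} :
    IsSmoothForm η ↔ ∀ (x₀ : M), ∀ z ∈ (extChartAt 𝓘(ℝ, E) x₀).target, ∀ k,
      ContDiffAt ℝ ∞ (fun y => η.inChart x₀ k y) z :=
  ⟨fun h x₀ _ hz k => (h x₀ k).contDiffAt ((isOpen_extChartAt_target x₀).mem_nhds hz),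
    fun h x₀ k z hz => (h x₀ z hz k).contDiffWithinAt⟩

theorem IsSmoothForm.add {η η' : FormField E M} (h : IsSmoothForm η) (h' : IsSmoothForm η') :
    IsSmoothForm (η + η') := fun x₀ k => (h x₀ k).add (h' x₀ k)

theorem IsSmoothForm.smul (r : ℝ) {η : FormField E M} (h : IsSmoothForm η) :
    IsSmoothForm (r • η) := fun x₀ k => (h x₀ k).const_smul r

variable [IsManifold 𝓘(ℝ, E) ∞ M]

/-- The exterior derivative is computed by the same formula in every chart. -/
theorem FormField.inChart_extDer {η : FormField E M} (hη : IsSmoothForm η) {x₀ : M} {z : E}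
    (hz : z ∈ (extChartAt 𝓘(ℝ, E) x₀).target) :
    (fun k => (extDer η).inChart x₀ k z) = flatExtDer (fun y k => η.inChart x₀ k y) z := by
  set x := (extChartAt 𝓘(ℝ, E) x₀).symm z with hxdef
  have hx : (extChartAt 𝓘(ℝ, E) x₀).symm z ∈ (extChartAt 𝓘(ℝ, E) x).source :=
    mem_extChartAt_source x
  have h1 : (fun y k => η.inChart x₀ k y) =ᶠ[nhds z] fun y k =>
      (η.inChart x k (transition x₀ x y)).compContinuousLinearMap
        (fderiv ℝ (transition x₀ x) y) :=
    (eventually_mem_transition_domain hz hx).mono fun y hy =>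
      funext fun k => η.inChart_transition k hy.1 hy.2
  rw [flatExtDer_congr h1, flatExtDer_pullback (η := fun y k => η.inChart x k y)
    (isSmoothForm_iff.1 hη x _ (transition_mem_target hx)) (contDiffAt_transition hz hx),
    fderiv_transition hz hx]
  funext k
  cases k <;> rfl

theorem IsSmoothForm.extDer_smooth {η : FormField E M} (hη : IsSmoothForm η) :
    IsSmoothForm (extDer η) := by
  rw [isSmoothForm_iff] at hη ⊢
  intro x₀ z hz k
  refine (contDiffAt_flatExtDer (hη x₀ z hz) k).congr_of_eventuallyEq ?_
  filter_upwards [(isOpen_extChartAt_target x₀).mem_nhds hz] with y hy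
  exact congrFun (FormField.inChart_extDer (isSmoothForm_iff.2 hη) hy) k

variable [FiniteDimensional ℝ E]

/-- The tangent spaces are copies of the model space, which is Hausdorff. -/
instance instT2SpaceTangentSpace (x : M) : T2Space (TangentSpace 𝓘(ℝ, E) x) :=
  inferInstanceAs (T2Space E)

/-- The tangent spaces are copies of the model space, which is finite-dimensional. -/
instance instFiniteDimensionalTangentSpace (x : M) :
    FiniteDimensional ℝ (TangentSpace 𝓘(ℝ, E) x) :=
  inferInstanceAs (FiniteDimensional ℝ E)

theorem FormField.inChart_interiorProd (P : MultivectorField E M) (η : FormField E M)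
    {x₀ : M} {z : E} (hz : z ∈ (extChartAt 𝓘(ℝ, E) x₀).target) :
    (fun k => (interiorProd P η).inChart x₀ k z) =
      contract (P.inChart x₀ z) (fun k => η.inChart x₀ k z) := by
  have h := contract_compContinuousLinearMap (chartSymmDeriv x₀ z) (P.inChart x₀ z)
    (η ((extChartAt 𝓘(ℝ, E) x₀).symm z))
  have h2 : ExteriorAlgebra.map (chartSymmDeriv x₀ z).toLinearMap (P.inChart x₀ z) =
      P ((extChartAt 𝓘(ℝ, E) x₀).symm z) := by
    rw [MultivectorField.inChart, map_map_exteriorAlgebra]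
    have h3 := congrArg ContinuousLinearMap.toLinearMap (chartSymmDeriv_comp_chartDeriv hz)
    rw [show (chartSymmDeriv x₀ z).toLinearMap ∘ₗ (chartDeriv x₀ _).toLinearMap = LinearMap.id
      from h3, ExteriorAlgebra.map_id]
    rfl
  rw [h2] at h
  exact h.symm

omit [FiniteDimensional ℝ E] in
theorem extDer_add {η η' : FormField E M} (h : IsSmoothForm η) (h' : IsSmoothForm η') :
    extDer (η + η') = extDer η + extDer η' := by
  refine FormField.ext_inChart fun x₀ z hz => ?_
  rw [FormField.inChart_extDer (h.add h') hz]
  change _ = (fun k => (extDer η).inChart x₀ k z) + fun k => (extDer η').inChart x₀ k z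
  rw [FormField.inChart_extDer h hz, FormField.inChart_extDer h' hz]
  funext k
  cases k with
  | zero => exact (add_zero _).symm
  | succ k =>
    exact extDeriv_fun_add ((isSmoothForm_iff.1 h x₀ z hz k).differentiableAt (by simp))
      ((isSmoothForm_iff.1 h' x₀ z hz k).differentiableAt (by simp))

omit [FiniteDimensional ℝ E] in
theorem extDer_smul (r : ℝ) {η : FormField E M} (h : IsSmoothForm η) :
    extDer (r • η) = r • extDer η := by
  refine FormField.ext_inChart fun x₀ z hz => ?_
  rw [FormField.inChart_extDer (h.smul r) hz]
  change _ = r • fun k => (extDer η).inChart x₀ k z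
  rw [FormField.inChart_extDer h hz]
  funext k
  cases k with
  | zero => exact (smul_zero r).symm
  | succ k => exact extDeriv_fun_smul r (fun y => η.inChart x₀ k y)

omit [FiniteDimensional ℝ E] in
theorem extDer_extDer {η : FormField E M} (h : IsSmoothForm η) : extDer (extDer η) = 0 := by
  refine FormField.ext_inChart fun x₀ z hz => ?_
  rw [FormField.inChart_extDer h.extDer_smooth hz]
  have h1 : ∀ᶠ y in nhds z, (fun k => (extDer η).inChart x₀ k y) =
      flatExtDer (fun y k => η.inChart x₀ k y) y := by
    filter_upwards [(isOpen_extChartAt_target x₀).mem_nhds hz] with y hy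
    exact FormField.inChart_extDer h hy
  rw [flatExtDer_congr h1, flatExtDer_flatExtDer (isSmoothForm_iff.1 h x₀ z hz)]
  rfl

omit [IsManifold 𝓘(ℝ, E) ∞ M] in
theorem IsMultivectorField.contDiffAt {d : ℤ} {P : MultivectorField E M}
    (hP : IsMultivectorField d P) {x₀ : M} {z : E}
    (hz : z ∈ (extChartAt 𝓘(ℝ, E) x₀).target) : ContDiffAt ℝ ∞ (P.inChart x₀) z :=
  (hP.smooth x₀).contDiffAt ((isOpen_extChartAt_target x₀).mem_nhds hz)

omit [IsManifold 𝓘(ℝ, E) ∞ M] in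
theorem IsMultivectorField.inChart_mem {d : ℤ} {P : MultivectorField E M}
    (hP : IsMultivectorField d P) (x₀ : M) (z : E) : P.inChart x₀ z ∈ vectorsOfDegree E d :=
  map_mem_vectorsOfDegree _ (hP.homogeneous _)

theorem IsSmoothForm.interiorProd_smooth {d : ℤ} {P : MultivectorField E M}
    (hP : IsMultivectorField d P) {η : FormField E M} (hη : IsSmoothForm η) :
    IsSmoothForm (interiorProd P η) := by
  rw [isSmoothForm_iff] at hη ⊢
  intro x₀ z hz k
  refine (contDiffAt_contract (hP.contDiffAt hz) (hη x₀ z hz) k).congr_of_eventuallyEq ?_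
  filter_upwards [(isOpen_extChartAt_target x₀).mem_nhds hz] with y hy
  exact congrFun (FormField.inChart_interiorProd P η hy) k

/-- The Schouten–Nijenhuis bracket is given by the same formula in every chart. -/
theorem MultivectorField.inChart_schouten {p q : ℤ} {P Q : MultivectorField E M}
    (hP : IsMultivectorField p P) (hQ : IsMultivectorField q Q) {x₀ : M} {z : E}
    (hz : z ∈ (extChartAt 𝓘(ℝ, E) x₀).target) :
    (schouten P Q).inChart x₀ z = schoutenFlat (P.inChart x₀) (Q.inChart x₀) z := by
  set x := (extChartAt 𝓘(ℝ, E) x₀).symm z with hxdef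
  have hx : (extChartAt 𝓘(ℝ, E) x₀).symm z ∈ (extChartAt 𝓘(ℝ, E) x).source :=
    mem_extChartAt_source x
  have hx' := transition_mem_target hx
  have hev := eventually_mem_transition_domain hz hx
  have h1 : schoutenFlat (P.inChart x) (Q.inChart x) (transition x₀ x z) =
      ExteriorAlgebra.map (fderiv ℝ (transition x₀ x) z).toLinearMap
        (schoutenFlat (P.inChart x₀) (Q.inChart x₀) z) :=
    schoutenFlat_pushforward (contDiffAt_transition hz hx) (hP.contDiffAt hz) (hQ.contDiffAt hz)
      (Filter.Eventually.of_forall (hP.inChart_mem x₀))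
      (Filter.Eventually.of_forall (hQ.inChart_mem x₀)) (hP.contDiffAt hx') (hQ.contDiffAt hx')
      (Filter.Eventually.of_forall (hP.inChart_mem x))
      (Filter.Eventually.of_forall (hQ.inChart_mem x))
      (hev.mono fun y hy => P.inChart_transition hy.1 hy.2)
      (hev.mono fun y hy => Q.inChart_transition hy.1 hy.2)
  change ExteriorAlgebra.map (chartDeriv x₀ x).toLinearMap
    (ExteriorAlgebra.map (chartDeriv x x).inverse.toLinearMap
      (schoutenFlat (P.inChart x) (Q.inChart x) (transition x₀ x z))) = _
  have h2 : (chartDeriv x x : E →L[ℝ] E).inverse = ContinuousLinearMap.id ℝ E := by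
    rw [show (chartDeriv x x : E →L[ℝ] E) = ContinuousLinearMap.id ℝ E from chartDeriv_self x]
    exact ContinuousLinearMap.inverse_id
  have h3 : ((chartDeriv x₀ x).toLinearMap ∘ₗ (chartDeriv x x).inverse.toLinearMap) ∘ₗ
      (fderiv ℝ (transition x₀ x) z).toLinearMap = LinearMap.id := by
    refine LinearMap.ext fun v => ?_
    change chartDeriv x₀ x ((chartDeriv x x).inverse (fderiv ℝ (transition x₀ x) z v)) = v
    rw [fderiv_transition hz hx]
    refine Eq.trans ?_ (DFunLike.congr_fun (chartDeriv_comp_chartSymmDeriv hz) v)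
    refine congrArg (chartDeriv x₀ x) ((DFunLike.congr_fun h2 _).trans ?_)
    exact DFunLike.congr_fun (chartDeriv_self x) (chartSymmDeriv x₀ z v)
  rw [h1, map_map_exteriorAlgebra, map_map_exteriorAlgebra, h3, ExteriorAlgebra.map_id]
  rfl

theorem IsMultivectorField.schouten {p q : ℤ} {P Q : MultivectorField E M}
    (hP : IsMultivectorField p P) (hQ : IsMultivectorField q Q) :
    IsMultivectorField (p + q - 1) (schouten P Q) where
  smooth x₀ z hz := by
    refine ((contDiffAt_schoutenFlat (hP.contDiffAt hz)
      (hQ.contDiffAt hz)).congr_of_eventuallyEq ?_).contDiffWithinAt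
    filter_upwards [(isOpen_extChartAt_target x₀).mem_nhds hz] with y hy
    exact MultivectorField.inChart_schouten hP hQ hy
  homogeneous x := map_mem_vectorsOfDegree _
    (schoutenFlat_mem_vectorsOfDegree (hP.contDiffAt (mem_extChartAt_target x))
      (hQ.contDiffAt (mem_extChartAt_target x))
      (Filter.Eventually.of_forall (hP.inChart_mem x))
      (Filter.Eventually.of_forall (hQ.inChart_mem x)))

omit [IsManifold 𝓘(ℝ, E) ∞ M] in
theorem schouten_antisymm {p q : ℤ} {P Q : MultivectorField E M}
    (hP : IsMultivectorField p P) (hQ : IsMultivectorField q Q) :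
    schouten P Q = -(-1 : ℝ) ^ ((p - 1) * (q - 1)) • schouten Q P := by
  funext x
  refine (congrArg _ (schoutenFlat_antisymm (hP.contDiffAt (mem_extChartAt_target x))
      (hQ.contDiffAt (mem_extChartAt_target x))
      (Filter.Eventually.of_forall (hP.inChart_mem x))
      (Filter.Eventually.of_forall (hQ.inChart_mem x)))).trans ?_
  exact map_smul (ExteriorAlgebra.map (chartDeriv x x).inverse.toLinearMap) _ _

omit [IsManifold 𝓘(ℝ, E) ∞ M] in
theorem IsMultivectorField.add {d : ℤ} {P Q : MultivectorField E M}
    (hP : IsMultivectorField d P) (hQ : IsMultivectorField d Q) :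
    IsMultivectorField d (P + Q) where
  smooth x₀ := ((hP.smooth x₀).add (hQ.smooth x₀)).congr fun _ _ =>
    map_add (ExteriorAlgebra.map (chartDeriv x₀ _).toLinearMap) _ _
  homogeneous x := add_mem (hP.homogeneous x) (hQ.homogeneous x)

omit [IsManifold 𝓘(ℝ, E) ∞ M] in
theorem IsMultivectorField.smul {d : ℤ} (r : ℝ) {P : MultivectorField E M}
    (hP : IsMultivectorField d P) : IsMultivectorField d (r • P) where
  smooth x₀ := ((hP.smooth x₀).const_smul r).congr fun z _ =>
    map_smul (ExteriorAlgebra.map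
      (chartDeriv x₀ ((extChartAt 𝓘(ℝ, E) x₀).symm z)).toLinearMap) r (P _)
  homogeneous x := Submodule.smul_mem _ r (hP.homogeneous x)

theorem FormField.inChart_lieDer {p d : ℤ} {P : MultivectorField E M}
    (hP : IsMultivectorField d P) {η : FormField E M} (hη : IsSmoothForm η) {x₀ : M} {z : E}
    (hz : z ∈ (extChartAt 𝓘(ℝ, E) x₀).target) :
    (fun k => (lieDer p P η).inChart x₀ k z) =
      flatLieDer p (P.inChart x₀) (fun y k => η.inChart x₀ k y) z := by
  have h1 : ∀ᶠ y in nhds z, (fun k => (interiorProd P η).inChart x₀ k y) =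
      contract (P.inChart x₀ y) (fun k => η.inChart x₀ k y) := by
    filter_upwards [(isOpen_extChartAt_target x₀).mem_nhds hz] with y hy
    exact FormField.inChart_interiorProd P η hy
  rw [flatLieDer, ← flatExtDer_congr h1, ← FormField.inChart_extDer hη hz,
    ← FormField.inChart_interiorProd P _ hz,
    ← FormField.inChart_extDer (hη.interiorProd_smooth hP) hz]
  rfl

end Operators

/-! ### The calculus of contractions and Lie derivatives -/

section Calculus

variable {E : Type*} [NormedAddCommGroup E] [NormedSpace ℝ E] [FiniteDimensional ℝ E]
  {M : Type*} [TopologicalSpace M] [ChartedSpace E M]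

theorem interiorProd_add_left (P Q : MultivectorField E M) (η : FormField E M) :
    interiorProd (P + Q) η = interiorProd P η + interiorProd Q η :=
  funext fun _ => contract_add_left _ _ _

theorem interiorProd_smul_left (r : ℝ) (P : MultivectorField E M) (η : FormField E M) :
    interiorProd (r • P) η = r • interiorProd P η :=
  funext fun _ => contract_smul_left _ _ _

theorem interiorProd_add_right (P : MultivectorField E M) (η η' : FormField E M) :
    interiorProd P (η + η') = interiorProd P η + interiorProd P η' :=
  funext fun _ => contract_add_right _ _ _

theorem interiorProd_smul_right (r : ℝ) (P : MultivectorField E M) (η : FormField E M) :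
    interiorProd P (r • η) = r • interiorProd P η :=
  funext fun _ => contract_smul_right _ _ _

theorem lieDer_eq_add (p : ℤ) (P : MultivectorField E M) (η : FormField E M) :
    lieDer p P η = extDer (interiorProd P η) + (-(-1 : ℝ) ^ p) • interiorProd P (extDer η) := by
  rw [lieDer]
  module

/-- Contractions commute up to sign. -/
theorem interiorProd_comm {p q : ℤ} {P Q : MultivectorField E M}
    (hP : IsMultivectorField p P) (hQ : IsMultivectorField q Q) (η : FormField E M) :
    interiorProd P (interiorProd Q η) = (-1 : ℝ) ^ (p * q) • interiorProd Q (interiorProd P η) := by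
  funext x
  refine (contract_contract (Q x) (P x) (η x)).trans ?_
  rw [mul_comm_of_mem (hQ.homogeneous x) (hP.homogeneous x), mul_comm q, contract_smul_left,
    ← contract_contract]
  rfl

theorem IsForm.interiorProd_homogeneous {n d : ℤ} {P : MultivectorField E M}
    (hP : IsMultivectorField d P) {η : FormField E M} (hη : IsForm n η) (x : M) {k : ℕ}
    (hk : (k : ℤ) ≠ n - d) : interiorProd P η x k = 0 :=
  contract_eq_zero_of_degree_ne (hP.homogeneous x) (hη.homogeneous x) hk

variable [IsManifold 𝓘(ℝ, E) ∞ M]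

theorem IsForm.interiorProd {n d : ℤ} {P : MultivectorField E M}
    (hP : IsMultivectorField d P) {η : FormField E M} (hη : IsForm n η) :
    IsForm (n - d) (interiorProd P η) where
  smooth := IsSmoothForm.interiorProd_smooth hP hη.smooth
  homogeneous x _ hk := hη.interiorProd_homogeneous hP x hk

theorem IsSmoothForm.lieDer_smooth {p d : ℤ} {P : MultivectorField E M}
    (hP : IsMultivectorField d P) {η : FormField E M} (hη : IsSmoothForm η) :
    IsSmoothForm (lieDer p P η) := by
  rw [lieDer_eq_add]
  exact (hη.interiorProd_smooth hP).extDer_smooth.add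
    ((hη.extDer_smooth.interiorProd_smooth hP).smul _)

theorem lieDer_add {p d : ℤ} {P : MultivectorField E M} (hP : IsMultivectorField d P)
    {η η' : FormField E M} (h : IsSmoothForm η) (h' : IsSmoothForm η') :
    lieDer p P (η + η') = lieDer p P η + lieDer p P η' := by
  rw [lieDer, lieDer, lieDer, interiorProd_add_right,
    extDer_add (h.interiorProd_smooth hP) (h'.interiorProd_smooth hP), extDer_add h h',
    interiorProd_add_right]
  module

theorem lieDer_smul {p d : ℤ} (r : ℝ) {P : MultivectorField E M} (hP : IsMultivectorField d P)
    {η : FormField E M} (h : IsSmoothForm η) :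
    lieDer p P (r • η) = r • lieDer p P η := by
  rw [lieDer, lieDer, interiorProd_smul_right, extDer_smul r (h.interiorProd_smooth hP),
    extDer_smul r h, interiorProd_smul_right]
  module

/-- The Lie derivative along `P` is the graded commutator of `d` and `ι_P`, hence it commutes with
`d` up to sign. -/
theorem extDer_lieDer {p d : ℤ} {P : MultivectorField E M} (hP : IsMultivectorField d P)
    {η : FormField E M} (h : IsSmoothForm η) :
    extDer (lieDer p P η) = (-1 : ℝ) ^ (p - 1) • lieDer p P (extDer η) := by
  have h1 := h.interiorProd_smooth hP
  have h2 := h.extDer_smooth.interiorProd_smooth hP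
  have h3 : interiorProd P (0 : FormField E M) = 0 := by
    simpa using interiorProd_smul_right 0 P (0 : FormField E M)
  rw [lieDer_eq_add, lieDer, extDer_add h1.extDer_smooth (h2.smul _),
    extDer_extDer h1, extDer_smul _ h2, extDer_extDer h, h3, neg_one_zpow_sub_one]
  module

/-- Contraction with the bracket is the graded commutator of a Lie derivative and a
contraction. -/
theorem interiorProd_schouten {p q : ℤ} {P Q : MultivectorField E M}
    (hP : IsMultivectorField p P) (hQ : IsMultivectorField q Q) {η : FormField E M}
    (hη : IsSmoothForm η) :
    interiorProd (schouten P Q) η = (-1 : ℝ) ^ ((p - 1) * q) • lieDer p P (interiorProd Q η) +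
      (-1 : ℝ) • interiorProd Q (lieDer p P η) := by
  refine FormField.ext_inChart fun x₀ z hz => ?_
  have h1 : ∀ᶠ y in nhds z, (fun k => (interiorProd Q η).inChart x₀ k y) =
      contract (Q.inChart x₀ y) (fun k => η.inChart x₀ k y) := by
    filter_upwards [(isOpen_extChartAt_target x₀).mem_nhds hz] with y hy
    exact FormField.inChart_interiorProd Q η hy
  have h2 := FormField.inChart_lieDer (p := p) hP (hη.interiorProd_smooth hQ) hz
  rw [flatLieDer_congr h1] at h2
  have h3 := FormField.inChart_interiorProd Q (lieDer p P η) hz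
  rw [FormField.inChart_lieDer hP hη hz] at h3
  have h4 := contract_schoutenFlat (hP.contDiffAt hz) (hQ.contDiffAt hz)
    (Filter.Eventually.of_forall (hP.inChart_mem x₀))
    (Filter.Eventually.of_forall (hQ.inChart_mem x₀)) (isSmoothForm_iff.1 hη x₀ z hz)
  rw [← h2, ← h3, ← MultivectorField.inChart_schouten hP hQ hz,
    ← FormField.inChart_interiorProd _ η hz] at h4
  exact h4

/-- The Lie derivative along the bracket is the graded commutator of the Lie derivatives. -/
theorem lieDer_schouten {p q : ℤ} {P Q : MultivectorField E M}
    (hP : IsMultivectorField p P) (hQ : IsMultivectorField q Q) {η : FormField E M}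
    (hη : IsSmoothForm η) :
    lieDer (p + q - 1) (schouten P Q) η =
      (-1 : ℝ) ^ ((p - 1) * (q - 1)) • lieDer p P (lieDer q Q η) +
        (-1 : ℝ) • lieDer q Q (lieDer p P η) := by
  have hQη := hη.interiorProd_smooth hQ
  have hdη := hη.extDer_smooth
  have hQdη := hdη.interiorProd_smooth hQ
  have hLη : IsSmoothForm (lieDer p P η) := hη.lieDer_smooth hP
  have hLQη : IsSmoothForm (lieDer p P (interiorProd Q η)) := hQη.lieDer_smooth hP
  have e1 : lieDer p P (lieDer q Q η) = lieDer p P (extDer (interiorProd Q η)) +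
      (-(-1 : ℝ) ^ q) • lieDer p P (interiorProd Q (extDer η)) := by
    rw [lieDer_eq_add q, lieDer_add hP hQη.extDer_smooth (hQdη.smul _), lieDer_smul _ hP hQdη]
  have e2 : lieDer q Q (lieDer p P η) = extDer (interiorProd Q (lieDer p P η)) +
      (-(-1 : ℝ) ^ q * (-1 : ℝ) ^ (p - 1)) • interiorProd Q (lieDer p P (extDer η)) := by
    rw [lieDer.eq_1 q, extDer_lieDer hP hη, interiorProd_smul_right]
    module
  rw [e1, e2, lieDer.eq_1 (p + q - 1), interiorProd_schouten hP hQ hη,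
    interiorProd_schouten hP hQ hdη, extDer_add (hLQη.smul _)
    ((hLη.interiorProd_smooth hQ).smul _), extDer_smul _ hLQη,
    extDer_smul _ (hLη.interiorProd_smooth hQ), extDer_lieDer hP hQη, neg_one_zpow_sub_one_mul,
    neg_one_zpow_sub_one_mul, mul_sub_one, zpow_sub₀ (by norm_num) (p * q) p,
    neg_one_zpow_sub_one, neg_one_zpow_sub_one, neg_one_zpow_sub_one, zpow_add₀ (by norm_num)]
  rcases Int.even_or_odd p with hp | hp
  · rw [hp.neg_one_zpow]; module
  · rw [hp.neg_one_zpow]; module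

end Calculus

/-! ### Conformal Hamiltonian forms -/

section ConformalHamiltonianForms

variable {E : Type*} [NormedAddCommGroup E] [NormedSpace ℝ E] [FiniteDimensional ℝ E]
  {M : Type*} [TopologicalSpace M] [ChartedSpace E M] [IsManifold 𝓘(ℝ, E) ∞ M]

/-- For `ι_X Θ = -α`, the two conditions `ℒ_X Θ = ι_V Θ` and
`ι_X dΘ = (-1)^(p+1) (dα + ι_V Θ)` are equivalent. -/
theorem lieDer_eq_iff_of_interiorProd_eq {n p : ℤ} {Θ α : FormField E M} (hΘ : IsForm n Θ)
    {X : MultivectorField E M} (hX : IsMultivectorField p X) (h : interiorProd X Θ = -α)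
    (V : MultivectorField E M) :
    lieDer p X Θ = interiorProd V Θ ↔
      interiorProd X (extDer Θ) = (-1 : ℝ) ^ (p + 1) • (extDer α + interiorProd V Θ) := by
  have hα : extDer α = (-1 : ℝ) • extDer (interiorProd X Θ) := by
    rw [← extDer_smul _ (IsSmoothForm.interiorProd_smooth hX hΘ.smooth), h,
      show (-1 : ℝ) • -α = α by module]
  rw [lieDer_eq_add, hα, zpow_add_one₀ (by norm_num)]
  have hp := neg_one_zpow_mul_self p
  generalize (-1 : ℝ) ^ p = s at *
  constructor
  · intro h'
    rw [← h']
    linear_combination (norm := module) -(hp • interiorProd X (extDer Θ))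
  · intro h'
    rw [h']
    linear_combination (norm := module) hp • (interiorProd V Θ - extDer (interiorProd X Θ))

theorem IsHamiltonianPair.lieDer_eq {n p : ℤ} {Θ α : FormField E M} (hΘ : IsForm n Θ)
    {X V : MultivectorField E M} (h : IsHamiltonianPair Θ p α X V) :
    lieDer p X Θ = interiorProd V Θ :=
  (lieDer_eq_iff_of_interiorProd_eq hΘ h.isMultivectorField h.interiorProd_eq V).2
    h.interiorProd_extDer_eq

/-- A conformal Hamiltonian form admits a Hamiltonian multivector field and a conformal factor. -/
theorem IsConformalHamiltonian.exists_isHamiltonianPair {n p : ℤ} {Θ α : FormField E M}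
    (hΘ : IsForm n Θ) (h : IsConformalHamiltonian n Θ p α) :
    ∃ X V, IsHamiltonianPair Θ p α X V := by
  obtain ⟨-, X, ⟨V, hX, hV, hL⟩, hα⟩ := h
  exact ⟨X, V, hX, hV, hα, (lieDer_eq_iff_of_interiorProd_eq hΘ hX hα V).1 hL⟩

/-- The contraction of `Θ` with the bracket of two Hamiltonian multivector fields depends on the
second one only through its Hamiltonian form. -/
theorem IsHamiltonianPair.interiorProd_schouten_eq {n p q : ℤ} {Θ α β : FormField E M}
    (hΘ : IsForm n Θ) {X V Y W : MultivectorField E M} (hα : IsHamiltonianPair Θ p α X V)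
    (hβ : IsHamiltonianPair Θ q β Y W) :
    interiorProd (schouten X Y) Θ = (-1 : ℝ) ^ ((p - 1) * q) • lieDer p X (-β) +
      (-1 : ℝ) • (-1 : ℝ) ^ (q * (p - 1)) • interiorProd V (-β) := by
  rw [interiorProd_schouten hα.isMultivectorField hβ.isMultivectorField hΘ.smooth,
    hα.lieDer_eq hΘ, hβ.interiorProd_eq,
    interiorProd_comm hβ.isMultivectorField hα.isMultivectorField_factor, hβ.interiorProd_eq]

/-- The contraction of `Θ` with the bracket of two Hamiltonian multivector fields depends only on
their Hamiltonian forms. -/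
theorem IsHamiltonianPair.interiorProd_schouten_congr {n p q : ℤ} {Θ α β : FormField E M}
    (hΘ : IsForm n Θ) {X V Y W X' V' Y' W' : MultivectorField E M}
    (hα : IsHamiltonianPair Θ p α X V) (hβ : IsHamiltonianPair Θ q β Y W)
    (hα' : IsHamiltonianPair Θ p α X' V') (hβ' : IsHamiltonianPair Θ q β Y' W') :
    interiorProd (schouten X Y) Θ = interiorProd (schouten X' Y') Θ := by
  -- First exchange `Y` for `Y'`; the antisymmetry of the bracket then allows the same for `X`.
  rw [hα.interiorProd_schouten_eq hΘ hβ, ← hα.interiorProd_schouten_eq hΘ hβ',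
    schouten_antisymm hα.isMultivectorField hβ'.isMultivectorField,
    schouten_antisymm hα'.isMultivectorField hβ'.isMultivectorField, interiorProd_smul_left,
    interiorProd_smul_left, hβ'.interiorProd_schouten_eq hΘ hα,
    hβ'.interiorProd_schouten_eq hΘ hα']

/-- The bracket of two Hamiltonian multivector fields is an infinitesimal conformal
transformation. -/
theorem IsHamiltonianPair.isInfConformalWith_schouten {n p q : ℤ} {Θ α β : FormField E M}
    (hΘ : IsForm n Θ) {X V Y W : MultivectorField E M} (hα : IsHamiltonianPair Θ p α X V)
    (hβ : IsHamiltonianPair Θ q β Y W) :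
    IsInfConformalWith Θ (p + q - 1) (schouten X Y)
      (schouten X W - (-1 : ℝ) ^ ((p - 1) * (q - 1)) • schouten Y V) := by
  have hX := hα.isMultivectorField
  have hV := hα.isMultivectorField_factor
  have hY := hβ.isMultivectorField
  have hW := hβ.isMultivectorField_factor
  rw [show schouten X W - (-1 : ℝ) ^ ((p - 1) * (q - 1)) • schouten Y V =
    schouten X W + (-(-1 : ℝ) ^ ((p - 1) * (q - 1))) • schouten Y V by module]
  refine ⟨hX.schouten hY, IsMultivectorField.add ?_ (IsMultivectorField.smul _ ?_), ?_⟩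
  · rw [show p + q - 1 - 1 = p + (q - 1) - 1 by ring]
    exact hX.schouten hW
  · rw [show p + q - 1 - 1 = q + (p - 1) - 1 by ring]
    exact hY.schouten hV
  · rw [lieDer_schouten hX hY hΘ.smooth, hα.lieDer_eq hΘ, hβ.lieDer_eq hΘ, interiorProd_add_left,
      interiorProd_smul_left, interiorProd_schouten hX hW hΘ.smooth,
      interiorProd_schouten hY hV hΘ.smooth, hα.lieDer_eq hΘ, hβ.lieDer_eq hΘ,
      interiorProd_comm hV hW, mul_comm (q - 1)]
    have hs := neg_one_zpow_mul_self ((p - 1) * (q - 1))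
    generalize (-1 : ℝ) ^ ((p - 1) * (q - 1)) = s at *
    linear_combination (norm := module) hs •
      (lieDer q Y (interiorProd V Θ) - interiorProd W (interiorProd V Θ))

end ConformalHamiltonianForms

end ConformalHamiltonian

end

theorem theorem2p3
    {E : Type*} [NormedAddCommGroup E] [NormedSpace ℝ E] [FiniteDimensional ℝ E]
    {M : Type*} [TopologicalSpace M] [ChartedSpace E M] [IsManifold 𝓘(ℝ, E) ∞ M]
    [T2Space M] [SecondCountableTopology M]
    (n p q : ℤ) (Θ : FormField E M) (hΘ : IsForm n Θ)
    (α β : FormField E M)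
    (hα : IsConformalHamiltonian n Θ p α) (hβ : IsConformalHamiltonian n Θ q β) :
    -- independence of the choices
    (∀ Xα Vα Xβ Vβ Xα' Vα' Xβ' Vβ' : MultivectorField E M,
      IsHamiltonianPair Θ p α Xα Vα → IsHamiltonianPair Θ q β Xβ Vβ →
      IsHamiltonianPair Θ p α Xα' Vα' → IsHamiltonianPair Θ q β Xβ' Vβ' →
      -interiorProd (schouten Xα Xβ) Θ = -interiorProd (schouten Xα' Xβ') Θ) ∧
    -- the form is conformal Hamiltonian, with the stated conformal factor
    (∀ Xα Vα Xβ Vβ : MultivectorField E M,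
      IsHamiltonianPair Θ p α Xα Vα → IsHamiltonianPair Θ q β Xβ Vβ →
      IsConformalHamiltonian n Θ (p + q - 1) (-interiorProd (schouten Xα Xβ) Θ) ∧
      IsInfConformalWith Θ (p + q - 1) (schouten Xα Xβ)
        (schouten Xα Vβ - (-1 : ℝ) ^ ((p - 1) * (q - 1)) • schouten Xβ Vα)) ∧
    -- hence `α` and `β` determine a unique form, their graded Jacobi bracket
    (∃! γ : FormField E M, ∀ Xα Vα Xβ Vβ : MultivectorField E M,
      IsHamiltonianPair Θ p α Xα Vα → IsHamiltonianPair Θ q β Xβ Vβ →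
      γ = -interiorProd (schouten Xα Xβ) Θ) := by
  refine ⟨fun Xα Vα Xβ Vβ Xα' Vα' Xβ' Vβ' h₁ h₂ h₁' h₂' => ?_, fun Xα Vα Xβ Vβ h₁ h₂ => ?_, ?_⟩
  · rw [h₁.interiorProd_schouten_congr hΘ h₂ h₁' h₂']
  · have h := h₁.isInfConformalWith_schouten hΘ h₂
    have hform := hΘ.interiorProd h.isMultivectorField
    refine ⟨⟨⟨fun x₀ k => (hform.smooth x₀ k).neg, fun x k hk => ?_⟩,
      schouten Xα Xβ, ⟨_, h⟩, (neg_neg _).symm⟩, h⟩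
    exact neg_eq_zero.2 (hform.homogeneous x k hk)
  · obtain ⟨X, V, hX⟩ := hα.exists_isHamiltonianPair hΘ
    obtain ⟨Y, W, hY⟩ := hβ.exists_isHamiltonianPair hΘ
    refine ⟨-interiorProd (schouten X Y) Θ, fun Xα Vα Xβ Vβ h₁ h₂ => ?_,
      fun γ hγ => hγ X V Y W hX hY⟩
    rw [hX.interiorProd_schouten_congr hΘ hY h₁ h₂]
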